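/- Let $G=(V,E)$ be a finite simple graph with $m$ edges, adjacency matrix $A=(a_{uv})$ and degrees $k_v$. Let $Q$ be the set of unordered pairs $\{st,uv\}$ of edges of $G$ without common vertices, $q=|Q|$, and let $n_G(F)$ be the number of (not necessarily induced) subgraphs of $G$ isomorphic to $F$. $L_r$ and $C_r$ are the path and the cycle on $r$ vertices, $\mathrm{paw}$ is a triangle with a pendant edge, $\oplus$ is disjoint union. Put $$K=\sum_{\{st,uv\}\in Q}(k_s+k_t+k_u+k_v),\quad \Phi_1=\sum_{Q}(k_sk_t+k_uk_v),\quad \Phi_2=\sum_{Q}(k_s+k_t)(k_u+k_v),$$ $$\Lambda_1=\sum_{Q}\bigl(k_s(a_{tu}+a_{tv})+k_t(a_{su}+a_{sv})+k_u(a_{sv}+a_{tv})+k_v(a_{su}+a_{tu})\bigr),\quad \Lambda_2=\sum_{Q}(a_{su}+a_{sv}+a_{tu}+a_{tv})(k_s+k_t+k_u+k_v).$$ The type of $(p,p')\in Q\times Q$ is the code $\tau\phi$, where $\tau$ is the number of common edges and $\phi$ the number of common vertices of $p$ and $p'$; code $02$ is split into $021$ (the two common vertices are joined by an edge of $p$ or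 of $p'$, as in $(\{st,uv\},\{su,wx\})$) and $022$ (otherwise, as in $(\{st,uv\},\{sw,ux\})$). So the types are $00,01,021,022,03,04,12,13,24$. Let $f_\omega$ be the number of elements of $Q\times Q$ of type $\omega$. (1) In every graph, $f_{24}=q$; $f_{13}=K-4q-2n_G(L_4)$; $f_{12}=2[(m+2)q+n_G(L_4)-K]$; $f_{04}=2n_G(C_4)=\tfrac14\mathrm{tr}(A^4)-n_G(L_3)-\tfrac12n_G(L_2)=\tfrac14\mathrm{tr}(A^4)+q-\tfrac12m^2$; $f_{03}=\Lambda_1-2n_G(L_4)-8n_G(C_4)-2n_G(\mathrm{paw})$; $f_{021}=2q+(m+5)n_G(L_4)+8n_G(C_4)+3n_G(\mathrm{paw})+\Phi_1-3n_G(C_3\oplus L_2)-\Lambda_1-\Lambda_2-K$; $f_{022}=4q+5n_G(L_4)+2n_G(\mathrm{paw})+4n_G(C_4)+\Phi_2-\Lambda_2-2K-n_G(L_5)$. If $G$ is a forest, $n_G(C_4)=n_G(\mathrm{paw})=n_G(C_3\oplus L_2)=0$. (2) A random layout consists of a random arrangement $\pi:V\to S$ of the vertices in a space $S$ and of the number of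 crossings between any two edges drawn between given positions. Suppose that almost surely no edge crosses itself, two edges cross at most once and edges that share a vertex do not cross, and that the number $C$ of crossings of $G$ counts crossings per pair of edges (so $e$ edges crossing at one point incur $\binom e2$ crossings). Let $\alpha(p)$ be the indicator that the two edges of $p$ cross, and suppose that the layout has constants $\delta$ and $E_\omega$, i.e. that for independent pairs of possible edges (pairs of distinct vertices) $\mathbb E[\alpha(p)]=\delta$ always and $\mathbb E[(\alpha(p)-\delta)(\alpha(p')-\delta)]=E_\omega$ whenever $(p,p')$ has type $\omega$. Then $\mathbb V[C]=X(G)+f_{00}E_{00}+f_{01}E_{01}$, where $$\begin{aligned}X(G)={}&q\,(E_{24}-4E_{13}+2(m+2)E_{12}+2E_{021}+4E_{022})+K(E_{13}-2E_{12}-E_{021}-2E_{022})\\&+n_G(L_4)(-2E_{13}+2E_{12}-2E_{03}+(m+5)E_{021}+5E_{022})+n_G(C_4)(2E_{04}-8E_{03}+8E_{021}+4E_{022})\\&+n_G(\mathrm{paw})(-2E_{03}+3E_{021}+2E_{022})+\Lambda_1(E_{03}-E_{021})-\Lambda_2(E_{021}+E_{022})\\&-n_G(L_5)E_{022}-3n_G(C_3\oplus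 L_2)E_{021}+\Phi_1E_{021}+\Phi_2E_{022}.\end{aligned}$$ In particular, if $E_{00}=E_{01}=0$, then $\mathbb V[C]=X(G)$, and if moreover $G$ is a forest, the terms with $n_G(C_4)$, $n_G(\mathrm{paw})$ and $n_G(C_3\oplus L_2)$ can be omitted. Such constants exist whenever the law of $\pi$ is invariant under permutations of $V$; they can be chosen with $E_{00}=E_{01}=0$ whenever the vertices are placed independently with a common law $\nu$ on $S$ and any point of $S$ can be moved to any other one by a map of $S$ that preserves $\nu$ and the numbers of crossings (as for uniformly random points on a sphere joined by geodesics). (3) The uniformly random linear arrangement (a uniformly random bijection $V\to\{1,\dots,n\}$, where two edges cross, once, if and only if their endpoints interleave) satisfies the crossing properties, with $\delta=1/3$ and $E_{00}=E_{01}=0$, $E_{24}=\frac29$, $E_{13}=\frac1{18}$, $E_{12}=\frac1{45}$, $E_{04}=-\frac19$, $E_{03}=-\frac1{36}$, $E_{021}=-\frac1{90}$, $E_{022}=\frac1{180}$, and $$\begin{aligned}\mathbb V[C]=\tfrac1{180}\bigl[&8(m+2)q+2K-(2m+7)n_G(L_4)-12n_G(C_4)+6n_G(\mathrm{paw})\\&-n_G(L_5)+6n_G(C_3\oplus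 L_2)-3\Lambda_1+\Lambda_2-2\Phi_1+\Phi_2\bigr].\end{aligned}$$ If $G$ is a forest, $$\mathbb V[C]=\tfrac1{180}\bigl[8(m+2)q+2K-(2m+7)n_G(L_4)-n_G(L_5)-3\Lambda_1+\Lambda_2-2\Phi_1+\Phi_2\bigr].$$ -/

import Mathlib

open MeasureTheory ProbabilityTheory

namespace EdgeCrossing

/-- The types of ordered pairs of elements of `Q`. -/
inductive PairType
  | t00 | t24 | t13 | t12 | t04 | t03 | t021 | t022 | t01
  deriving DecidableEq

instance : Fintype PairType where
  elems := {.t00, .t24, .t13, .t12, .t04, .t03, .t021, .t022, .t01}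
  complete x := by cases x <;> simp

noncomputable section

section Graph

variable {V : Type*} [DecidableEq V]

/-- The set of vertices covered by a set of edges. -/
def vertices (p : Finset (Sym2 V)) : Finset V := p.biUnion Sym2.toFinset

/-- The type of `(p, q)`, where `p` and `q` are pairs of independent edges. The first digit is the
number of common edges, the second digit the number of common vertices. When there are no common
edges and two common vertices, the subtype is `1` if the two common vertices are joined by one of
the edges of `p` or of `q`, as in `({st, uv}, {su, wx})`, and `2` otherwise,
as in `({st, uv}, {sw, ux})`. The other combinations of digits do not occur. -/
def typeOf (p q : Finset (Sym2 V)) : PairType :=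
  match (p ∩ q).card, (vertices p ∩ vertices q).card with
  | 0, 0 => .t00
  | 0, 1 => .t01
  | 0, 2 => if ∃ e ∈ p ∪ q, e.toFinset = vertices p ∩ vertices q then .t021 else .t022
  | 0, 3 => .t03
  | 0, 4 => .t04
  | 1, 2 => .t12
  | 1, 3 => .t13
  | _, _ => .t24

variable [Fintype V] (G : SimpleGraph V) [DecidableRel G.Adj]

/-- `Q`: the set of unordered pairs of independent edges, i.e. edges without common vertices. -/
def indepPairs : Finset (Finset (Sym2 V)) :=
  {p ∈ G.edgeFinset.powersetCard 2 | ∀ e ∈ p, ∀ f ∈ p, e ≠ f → Disjoint e.toFinset f.toFinset}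

/-- `f_ω`: the number of elements of `Q × Q` of type `ω`. -/
def freq (ω : PairType) : ℝ :=
  ((indepPairs G ×ˢ indepPairs G).filter fun x => typeOf x.1 x.2 = ω).card

/-- The sum over `{st, uv} ∈ Q` of `F s t u v`. Every element of `Q` can be written as `{st, uv}`
in exactly eight ways, over which the value of `F` is averaged; below, `F` always takes the same
value on all of them. -/
def sumQ (F : V → V → V → V → ℝ) : ℝ :=
  ∑ p ∈ indepPairs G, (1 / 8) * ∑ s, ∑ t, ∑ u, ∑ v,
    if p = {s(s, t), s(u, v)} then F s t u v else 0

/-- The number of edges. -/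
def m : ℝ := G.edgeFinset.card

/-- The number of pairs of independent edges. -/
def q : ℝ := (indepPairs G).card

/-- The degree of a vertex. -/
def k (v : V) : ℝ := G.degree v

/-- The entries of the adjacency matrix. -/
def a (u v : V) : ℝ := G.adjMatrix ℝ u v

def K : ℝ := sumQ G fun s t u v => k G s + k G t + k G u + k G v

def Phi1 : ℝ := sumQ G fun s t u v => k G s * k G t + k G u * k G v

def Phi2 : ℝ := sumQ G fun s t u v => (k G s + k G t) * (k G u + k G v)

def Lambda1 : ℝ := sumQ G fun s t u v =>
  k G s * (a G t u + a G t v) + k G t * (a G s u + a G s v)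
    + k G u * (a G s v + a G t v) + k G v * (a G s u + a G t u)

def Lambda2 : ℝ := sumQ G fun s t u v =>
  (a G s u + a G s v + a G t u + a G t v) * (k G s + k G t + k G u + k G v)

end Graph

section SubgraphCounts

variable {V : Type*} [Fintype V] (G : SimpleGraph V)

/-- The paw: a triangle with a pendant edge. -/
def pawGraph : SimpleGraph (Fin 4) :=
  SimpleGraph.fromEdgeSet {s(0, 1), s(1, 2), s(0, 2), s(2, 3)}

/-- The number of subgraphs of `G` (not necessarily induced) isomorphic to the path on `r`
vertices. -/
def nL (r : ℕ) : ℝ := G.copyCount (SimpleGraph.pathGraph r)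

/-- The number of subgraphs of `G` isomorphic to the cycle on four vertices. -/
def nC4 : ℝ := G.copyCount (SimpleGraph.cycleGraph 4)

/-- The number of subgraphs of `G` isomorphic to the paw. -/
def nPaw : ℝ := G.copyCount pawGraph

/-- The number of subgraphs of `G` isomorphic to the disjoint union of a triangle and an edge. -/
def nC3L2 : ℝ := G.copyCount (SimpleGraph.cycleGraph 3 ⊕g SimpleGraph.pathGraph 2)

end SubgraphCounts

section Formulas

variable {V : Type*} [Fintype V] [DecidableEq V] (G : SimpleGraph V) [DecidableRel G.Adj]

open PairType

/-- The arithmetic expression for the variance of the number of crossings in a general graph. -/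
def varianceExpr (E : PairType → ℝ) : ℝ :=
  q G * (E t24 - 4 * E t13 + 2 * (m G + 2) * E t12 + 2 * E t021 + 4 * E t022)
    + K G * (E t13 - 2 * E t12 - E t021 - 2 * E t022)
    + nL G 4 * (-2 * E t13 + 2 * E t12 - 2 * E t03 + (m G + 5) * E t021 + 5 * E t022)
    + nC4 G * (2 * E t04 - 8 * E t03 + 8 * E t021 + 4 * E t022)
    + nPaw G * (-2 * E t03 + 3 * E t021 + 2 * E t022)
    + Lambda1 G * (E t03 - E t021)
    - Lambda2 G * (E t021 + E t022)
    - nL G 5 * E t022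
    - 3 * nC3L2 G * E t021
    + Phi1 G * E t021
    + Phi2 G * E t022

/-- The arithmetic expression for the variance of the number of crossings in a forest. -/
def varianceExprForest (E : PairType → ℝ) : ℝ :=
  q G * (E t24 - 4 * E t13 + 2 * (m G + 2) * E t12 + 2 * E t021 + 4 * E t022)
    + K G * (E t13 - 2 * E t12 - E t021 - 2 * E t022)
    + nL G 4 * (-2 * E t13 + 2 * E t12 - 2 * E t03 + (m G + 5) * E t021 + 5 * E t022)
    + Lambda1 G * (E t03 - E t021)
    - Lambda2 G * (E t021 + E t022)
    - nL G 5 * E t022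
    + Phi1 G * E t021
    + Phi2 G * E t022

end Formulas

section Layout

/-- A random layout of the vertex set `V` in the space `S`: the law of the random arrangement
`π : V → S`, and, for any two edges drawn between given (unordered) pairs of positions, the number
of times that they cross. -/
structure RandomLayout (V S : Type*) [MeasurableSpace S] where
  law : Measure (V → S)
  isProbabilityMeasure : IsProbabilityMeasure law
  crossings : Sym2 S → Sym2 S → ℕ
  crossings_comm : ∀ a b, crossings a b = crossings b a
  measurable_crossings :
    ∀ e f : Sym2 V, Measurable fun π : V → S => crossings (e.map π) (f.map π)

namespace RandomLayout

variable {V S : Type*} [MeasurableSpace S] (L : RandomLayout V S)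

/-- The number of crossings of the edges `e` and `f` in the arrangement `π`. -/
def cr (π : V → S) (e f : Sym2 V) : ℕ := L.crossings (e.map π) (f.map π)

/-- The first three crossing properties, required of almost every arrangement and of all the
possible edges (unordered pairs of distinct vertices): no edge crosses itself, two edges cross at
most once, and two distinct edges that share a vertex do not cross. -/
structure IsGood : Prop where
  no_self : ∀ᵐ π ∂L.law, ∀ e : Sym2 V, ¬ e.IsDiag → L.cr π e e = 0
  once : ∀ᵐ π ∂L.law, ∀ e f : Sym2 V, ¬ e.IsDiag → ¬ f.IsDiag → L.cr π e f ≤ 1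
  incident : ∀ᵐ π ∂L.law, ∀ e f : Sym2 V, ¬ e.IsDiag → ¬ f.IsDiag → e ≠ f →
    (∃ v, v ∈ e ∧ v ∈ f) → L.cr π e f = 0

/-- The number of crossings of a drawing of `G`: the sum over all the unordered pairs of edges
(an edge may be paired with itself) of the number of times that they cross. Crossings are counted
per pair of edges, so `r` edges that cross at one point contribute `r.choose 2`, which is the fourth
crossing property. -/
def C [Fintype V] [DecidableEq V] (G : SimpleGraph V) [DecidableRel G.Adj] (π : V → S) : ℕ :=
  ∑ z ∈ G.edgeFinset.sym2,
    Sym2.lift ⟨fun e f => L.cr π e f, fun _ _ => L.crossings_comm _ _⟩ z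

variable [DecidableEq V]

/-- `α(e₁, e₂)` for `p = {e₁, e₂}`: the indicator that the two edges of `p` cross. -/
def α (p : Finset (Sym2 V)) (π : V → S) : ℝ :=
  if ∃ e ∈ p, ∃ f ∈ p, e ≠ f ∧ L.cr π e f ≠ 0 then 1 else 0

/-- `δ` and `E ω` are the constants of the layout: `δ` is the probability that two independent
edges cross, and `E ω` is the expectation of `β(e₁, e₂) β(e₃, e₄)`, where `β = α - δ`, for
`({e₁, e₂}, {e₃, e₄})` of type `ω`. -/
structure HasConstants [Fintype V] (δ : ℝ) (E : PairType → ℝ) : Prop where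
  prob_eq : ∀ p ∈ indepPairs (⊤ : SimpleGraph V), ∫ π, L.α p π ∂L.law = δ
  expect_eq : ∀ p ∈ indepPairs (⊤ : SimpleGraph V), ∀ r ∈ indepPairs (⊤ : SimpleGraph V),
    ∫ π, (L.α p π - δ) * (L.α r π - δ) ∂L.law = E (typeOf p r)

/-- The law of the arrangement is invariant under permutations of the vertices. -/
def IsExchangeable : Prop :=
  ∀ σ : Equiv.Perm V, L.law.map (fun π => π ∘ σ) = L.law

/-- The vertices are placed independently according to a common law `ν` on `S`, and `S` looks the
same from each of its points: any point can be moved to any other one by a map that preserves `ν`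
and the crossings. An example is the uniform distribution on the sphere, with edges drawn as
geodesics. -/
def IsHomogeneous [Fintype V] : Prop :=
  ∃ ν : Measure S, IsProbabilityMeasure ν ∧ L.law = Measure.pi (fun _ => ν) ∧
    ∀ x y : S, ∃ g : S → S, MeasurePreserving g ν ν ∧ g x = y ∧
      ∀ a b : Sym2 S, L.crossings (a.map g) (b.map g) = L.crossings a b

end RandomLayout

section Linear

variable (V : Type*) [Fintype V]

/-- The linear arrangements of `V`: the bijections from `V` to the positions `0, …, n - 1`. -/
def linearArrangements : Set (V → Fin (Fintype.card V)) := {π | Function.Bijective π}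

theorem linearArrangements_nonempty : (linearArrangements V).Nonempty :=
  ⟨Fintype.equivFin V, (Fintype.equivFin V).bijective⟩

/-- Two edges drawn as arcs above the line cross once if their endpoints interleave, and do not
cross otherwise. -/
def arcCrossings {n : ℕ} (a b : Sym2 (Fin n)) : ℕ :=
  if (a.inf < b.inf ∧ b.inf < a.sup ∧ a.sup < b.sup) ∨
    (b.inf < a.inf ∧ a.inf < b.sup ∧ b.sup < a.sup) then 1 else 0

/-- The uniformly random linear arrangement. -/
def rla : RandomLayout V (Fin (Fintype.card V)) where
  law := uniformOn (linearArrangements V)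
  isProbabilityMeasure :=
    isProbabilityMeasure_uniformOn (Set.toFinite _) (linearArrangements_nonempty V)
  crossings := arcCrossings
  crossings_comm a b := by simp only [arcCrossings, or_comm]
  measurable_crossings _ _ := Measurable.of_discrete

/-- The values of `E ω` in uniformly random linear arrangements. -/
def rlaConstants : PairType → ℝ
  | .t00 => 0
  | .t24 => 2 / 9
  | .t13 => 1 / 18
  | .t12 => 1 / 45
  | .t04 => -1 / 9
  | .t03 => -1 / 36
  | .t021 => -1 / 90
  | .t022 => 1 / 180
  | .t01 => 0

end Linear

end Layout

end

end EdgeCrossing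

open EdgeCrossing EdgeCrossing.PairType

set_option linter.unusedSectionVars false

/-! The variance is the sum over `Q × Q` of the covariances of crossing indicators, and a covariance
depends only on the type. So a count of the pairs of each type and the values of the constants are
all that is needed.

Counting. Up to the order of its components, every element of `Q × Q` is the image of the canonical
pair of its type under an injection (`exists_isPattern`). Double counting these injections
(`patSymm_mul_freq`) gives `freq G ω`, up to a constant, as `embCount G E`: the number of injections
that send a fixed small edge set `E` into `G`. Subgraph counts are such numbers too, divided by the
order of an automorphism group (`copyCount_mul_card`), while `K`, `Phi1`, `Phi2`, `Lambda1`,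
`Lambda2` count injections with degree weights. A degree is a sum over neighbours, and a neighbour
of a pattern vertex is either in the pattern, which adds a chord, or outside, which adds a pendant
vertex (`embDeg_eq`). In the same way `2m`, a sum of degrees, multiplies an embedding count
(`two_mul_m_mul_embCount`). Everything becomes a linear combination of embedding counts of about a
dozen graphs, and the formulas follow by linear elimination.

Constants. In an exchangeable layout they exist because two pairs of the same type are carried to
each other by a permutation of the vertices (`exists_perm_of_typeOf_eq`). In a homogeneous layout
the crossing probability of a pair, conditional on the position of one of its vertices, is still
`δ`; pairs that share at most that vertex are therefore uncorrelated
(`IsHomogeneous.integral_eq_zero`).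

Linear arrangements. Exactly one of the three perfect matchings of four points on a line has a
crossing. This gives `δ = 1/3` and, after multiplication by the centred indicator of a fixed pair,
linear relations between the constants (`rla_sum_constants`). Together with `E t24 = δ - δ²` and two
finite enumerations for `t13` and `t12`, they determine all the constants. -/

namespace EdgeCrossing

/-! ### Types as isomorphism classes: canonical pairs and their images -/

section Patterns

variable {V W : Type*} [DecidableEq V]

/-- The image of a set of edges under a map of the vertices. -/
def mapEdges (f : W → V) (p : Finset (Sym2 W)) : Finset (Sym2 V) := p.image (Sym2.map f)

@[simp]
theorem mapEdges_pair [DecidableEq W] (f : W → V) (s t u v : W) :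
    mapEdges f {s(s, t), s(u, v)} = {s(f s, f t), s(f u, f v)} := by
  simp [mapEdges, Finset.image_insert]

theorem mapEdges_mapEdges {U : Type*} [DecidableEq U] (g : V → U) (f : W → V)
    (p : Finset (Sym2 W)) : mapEdges g (mapEdges f p) = mapEdges (g ∘ f) p := by
  simp [mapEdges, Finset.image_image, Sym2.map_comp]

theorem mapEdges_injective {f : W → V} (hf : Function.Injective f) :
    Function.Injective (mapEdges f) :=
  Finset.image_injective (Sym2.map.injective hf)

theorem toFinset_map [DecidableEq W] (f : W → V) (e : Sym2 W) :
    (e.map f).toFinset = e.toFinset.image f := by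
  ext v; simp [Sym2.mem_map]

theorem vertices_mapEdges [DecidableEq W] (f : W → V) (p : Finset (Sym2 W)) :
    vertices (mapEdges f p) = (vertices p).image f := by
  ext v
  simp only [vertices, mapEdges, Finset.mem_biUnion, Finset.mem_image, Sym2.mem_toFinset]
  constructor
  · rintro ⟨_, ⟨e, he, rfl⟩, hv⟩
    obtain ⟨w, hw, rfl⟩ := Sym2.mem_map.1 hv
    exact ⟨w, ⟨e, he, hw⟩, rfl⟩
  · rintro ⟨w, ⟨e, he, hw⟩, rfl⟩
    exact ⟨_, ⟨e, he, rfl⟩, Sym2.mem_map.2 ⟨w, hw, rfl⟩⟩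

theorem vertices_pair (s t u v : V) : vertices {s(s, t), s(u, v)} = {s, t, u, v} := by
  ext x; simp [vertices, or_assoc]

theorem typeOf_comm (p r : Finset (Sym2 V)) : typeOf p r = typeOf r p := by
  unfold typeOf
  rw [Finset.inter_comm p r, Finset.inter_comm (vertices p), Finset.union_comm p r]

theorem typeOf_mapEdges [DecidableEq W] {f : W → V} (hf : Function.Injective f)
    (p r : Finset (Sym2 W)) :
    typeOf (mapEdges f p) (mapEdges f r) = typeOf p r := by
  unfold typeOf
  have h1 : (mapEdges f p ∩ mapEdges f r).card = (p ∩ r).card := by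
    rw [mapEdges, mapEdges, ← Finset.image_inter _ _ (Sym2.map.injective hf),
      Finset.card_image_of_injective _ (Sym2.map.injective hf)]
  have h2 : vertices (mapEdges f p) ∩ vertices (mapEdges f r)
      = (vertices p ∩ vertices r).image f := by
    rw [vertices_mapEdges, vertices_mapEdges, Finset.image_inter _ _ hf]
  have h3 : (∃ e ∈ mapEdges f p ∪ mapEdges f r,
      e.toFinset = vertices (mapEdges f p) ∩ vertices (mapEdges f r)) ↔
      ∃ e ∈ p ∪ r, e.toFinset = vertices p ∩ vertices r := by
    rw [h2, mapEdges, mapEdges, ← Finset.image_union, Finset.exists_mem_image]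
    simp only [toFinset_map, (Finset.image_injective hf).eq_iff]
  simp only [h1, h3]
  rw [h2, Finset.card_image_of_injective _ hf]

section Pairs

variable [Fintype V] {G : SimpleGraph V} [DecidableRel G.Adj]

theorem pair_mem_indepPairs {s t u v : V} :
    ({s(s, t), s(u, v)} : Finset (Sym2 V)) ∈ indepPairs G ↔
      G.Adj s t ∧ G.Adj u v ∧ s ≠ u ∧ s ≠ v ∧ t ≠ u ∧ t ≠ v := by
  rw [indepPairs, Finset.mem_filter, Finset.mem_powersetCard]
  constructor
  · rintro ⟨⟨h1, h2⟩, h3⟩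
    have hne : s(s, t) ≠ s(u, v) := by
      intro h; rw [h] at h2; simp at h2
    have h4 := h3 _ (by simp) _ (by simp) hne
    simp only [Finset.disjoint_left, Sym2.mem_toFinset, Sym2.mem_iff] at h4
    simp only [Finset.insert_subset_iff, Finset.singleton_subset_iff, SimpleGraph.mem_edgeFinset,
      SimpleGraph.mem_edgeSet] at h1
    refine ⟨h1.1, h1.2, ?_, ?_, ?_, ?_⟩ <;> rintro rfl <;> simp at h4
  · rintro ⟨h1, h2, h3, h4, h5, h6⟩
    have hne : s(s, t) ≠ s(u, v) := by simp [h3, h4]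
    refine ⟨⟨?_, Finset.card_pair hne⟩, ?_⟩
    · simp [Finset.insert_subset_iff, h1, h2]
    · have hd : Disjoint (s(s, t)).toFinset (s(u, v)).toFinset := by
        simp only [Finset.disjoint_left, Sym2.mem_toFinset, Sym2.mem_iff]
        rintro x (rfl | rfl) <;> tauto
      simp only [Finset.mem_insert, Finset.mem_singleton]
      rintro e (rfl | rfl) f (rfl | rfl) hef
      · exact absurd rfl hef
      · exact hd
      · exact hd.symm
      · exact absurd rfl hef

theorem pair_mem_indepPairs_top {s t u v : V} :
    ({s(s, t), s(u, v)} : Finset (Sym2 V)) ∈ indepPairs (⊤ : SimpleGraph V) ↔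
      s ≠ t ∧ u ≠ v ∧ s ≠ u ∧ s ≠ v ∧ t ≠ u ∧ t ≠ v :=
  pair_mem_indepPairs

theorem mem_indepPairs {p : Finset (Sym2 V)} :
    p ∈ indepPairs G ↔ ∃ s t u v, (G.Adj s t ∧ G.Adj u v ∧ s ≠ u ∧ s ≠ v ∧ t ≠ u ∧ t ≠ v) ∧
      p = {s(s, t), s(u, v)} := by
  constructor
  · intro hp
    have h2 : p.card = 2 := (Finset.mem_powersetCard.1 (Finset.mem_filter.1 hp).1).2
    obtain ⟨e, f, -, rfl⟩ := Finset.card_eq_two.1 h2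
    induction e with | _ s t
    induction f with | _ u v
    exact ⟨s, t, u, v, pair_mem_indepPairs.1 hp, rfl⟩
  · rintro ⟨s, t, u, v, h, rfl⟩
    exact pair_mem_indepPairs.2 h

/-- Independence does not involve `G`. This allows patterns and layout constants to be treated once,
in the complete graph. -/
theorem mem_indepPairs_iff_subset {p : Finset (Sym2 V)} :
    p ∈ indepPairs G ↔ p ∈ indepPairs (⊤ : SimpleGraph V) ∧ p ⊆ G.edgeFinset := by
  simp only [indepPairs, Finset.mem_filter, Finset.mem_powersetCard]
  refine ⟨fun h => ⟨⟨⟨fun e he => ?_, h.1.2⟩, h.2⟩, h.1.1⟩, fun h => ⟨⟨h.2, h.1.1.2⟩, h.1.2⟩⟩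
  exact SimpleGraph.edgeFinset_mono (le_top : G ≤ ⊤) (h.1.1 he)

theorem mapEdges_mem_indepPairs_top [Fintype W] [DecidableEq W] {f : W → V}
    (hf : Function.Injective f)
    {p : Finset (Sym2 W)} (hp : p ∈ indepPairs (⊤ : SimpleGraph W)) :
    mapEdges f p ∈ indepPairs (⊤ : SimpleGraph V) := by
  obtain ⟨s, t, u, v, h, rfl⟩ := mem_indepPairs.1 hp
  rw [mapEdges_pair, pair_mem_indepPairs]
  simpa [hf.eq_iff] using h

/-- Any endpoint of a pair of independent edges can be taken as the first one. -/
theorem exists_eq_of_mem_vertices {p : Finset (Sym2 V)} (hp : p ∈ indepPairs G) {s : V}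
    (hs : s ∈ vertices p) :
    ∃ t u v, (G.Adj s t ∧ G.Adj u v ∧ s ≠ u ∧ s ≠ v ∧ t ≠ u ∧ t ≠ v) ∧
      p = {s(s, t), s(u, v)} := by
  obtain ⟨a, b, c, d, h, rfl⟩ := mem_indepPairs.1 hp
  simp only [vertices_pair, Finset.mem_insert, Finset.mem_singleton] at hs
  rcases hs with rfl | rfl | rfl | rfl
  · exact ⟨b, c, d, h, rfl⟩
  · exact ⟨a, c, d, by have := h.1.symm; tauto, by rw [Sym2.eq_swap]⟩
  · exact ⟨d, a, b, by tauto, by rw [Finset.pair_comm]⟩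
  · exact ⟨c, a, b, by have := h.2.1.symm; tauto, by rw [Finset.pair_comm, Sym2.eq_swap]⟩

/-- Either two endpoints are joined by an edge of the pair, or they belong to different edges. -/
theorem exists_eq_of_mem_vertices_of_mem_vertices {p : Finset (Sym2 V)} (hp : p ∈ indepPairs G)
    {s x : V} (hs : s ∈ vertices p) (hx : x ∈ vertices p) (hsx : s ≠ x) :
    (∃ u v, (G.Adj s x ∧ G.Adj u v ∧ s ≠ u ∧ s ≠ v ∧ x ≠ u ∧ x ≠ v) ∧ p = {s(s, x), s(u, v)}) ∨
    ∃ t v, (G.Adj s t ∧ G.Adj x v ∧ s ≠ x ∧ s ≠ v ∧ t ≠ x ∧ t ≠ v) ∧ p = {s(s, t), s(x, v)} := by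
  obtain ⟨t, u, v, h, rfl⟩ := exists_eq_of_mem_vertices hp hs
  simp only [vertices_pair, Finset.mem_insert, Finset.mem_singleton] at hx
  rcases hx with rfl | rfl | rfl | rfl
  · exact absurd rfl hsx
  · exact .inl ⟨u, v, h, rfl⟩
  · exact .inr ⟨t, v, h, rfl⟩
  · exact .inr ⟨t, u, by have := h.2.1.symm; tauto, by rw [Sym2.eq_swap (a := u)]⟩

end Pairs

/-- The number of vertices covered by a pair of the given type. -/
def patSize : PairType → ℕ
  | t00 => 8 | t24 => 4 | t13 => 5 | t12 => 6 | t04 => 4 | t03 => 5 | t021 => 6 | t022 => 6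
  | t01 => 7

/-- The first component of the canonical pair of the given type. -/
def patFst : (ω : PairType) → Finset (Sym2 (Fin (patSize ω)))
  | t00 => ({s(0, 1), s(2, 3)} : Finset (Sym2 (Fin 8)))
  | t24 => ({s(0, 1), s(2, 3)} : Finset (Sym2 (Fin 4)))
  | t13 => ({s(0, 1), s(2, 3)} : Finset (Sym2 (Fin 5)))
  | t12 => ({s(0, 1), s(2, 3)} : Finset (Sym2 (Fin 6)))
  | t04 => ({s(0, 1), s(2, 3)} : Finset (Sym2 (Fin 4)))
  | t03 => ({s(0, 1), s(2, 3)} : Finset (Sym2 (Fin 5)))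
  | t021 => ({s(0, 1), s(2, 3)} : Finset (Sym2 (Fin 6)))
  | t022 => ({s(0, 1), s(2, 3)} : Finset (Sym2 (Fin 6)))
  | t01 => ({s(0, 1), s(2, 3)} : Finset (Sym2 (Fin 7)))

/-- The second component of the canonical pair of the given type. -/
def patSnd : (ω : PairType) → Finset (Sym2 (Fin (patSize ω)))
  | t00 => ({s(4, 5), s(6, 7)} : Finset (Sym2 (Fin 8)))
  | t24 => ({s(0, 1), s(2, 3)} : Finset (Sym2 (Fin 4)))
  | t13 => ({s(0, 1), s(2, 4)} : Finset (Sym2 (Fin 5)))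
  | t12 => ({s(0, 1), s(4, 5)} : Finset (Sym2 (Fin 6)))
  | t04 => ({s(0, 2), s(1, 3)} : Finset (Sym2 (Fin 4)))
  | t03 => ({s(0, 2), s(3, 4)} : Finset (Sym2 (Fin 5)))
  | t021 => ({s(0, 2), s(4, 5)} : Finset (Sym2 (Fin 6)))
  | t022 => ({s(0, 4), s(2, 5)} : Finset (Sym2 (Fin 6)))
  | t01 => ({s(0, 4), s(5, 6)} : Finset (Sym2 (Fin 7)))

theorem typeOf_pat (ω : PairType) : typeOf (patFst ω) (patSnd ω) = ω := by
  cases ω <;> decide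

theorem patFst_mem : ∀ ω, patFst ω ∈ indepPairs (⊤ : SimpleGraph (Fin (patSize ω)))
  | t00 => (pair_mem_indepPairs_top (V := Fin 8)).2 (by decide)
  | t24 => (pair_mem_indepPairs_top (V := Fin 4)).2 (by decide)
  | t13 => (pair_mem_indepPairs_top (V := Fin 5)).2 (by decide)
  | t12 => (pair_mem_indepPairs_top (V := Fin 6)).2 (by decide)
  | t04 => (pair_mem_indepPairs_top (V := Fin 4)).2 (by decide)
  | t03 => (pair_mem_indepPairs_top (V := Fin 5)).2 (by decide)
  | t021 => (pair_mem_indepPairs_top (V := Fin 6)).2 (by decide)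
  | t022 => (pair_mem_indepPairs_top (V := Fin 6)).2 (by decide)
  | t01 => (pair_mem_indepPairs_top (V := Fin 7)).2 (by decide)

theorem patSnd_mem : ∀ ω, patSnd ω ∈ indepPairs (⊤ : SimpleGraph (Fin (patSize ω)))
  | t00 => (pair_mem_indepPairs_top (V := Fin 8)).2 (by decide)
  | t24 => (pair_mem_indepPairs_top (V := Fin 4)).2 (by decide)
  | t13 => (pair_mem_indepPairs_top (V := Fin 5)).2 (by decide)
  | t12 => (pair_mem_indepPairs_top (V := Fin 6)).2 (by decide)
  | t04 => (pair_mem_indepPairs_top (V := Fin 4)).2 (by decide)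
  | t03 => (pair_mem_indepPairs_top (V := Fin 5)).2 (by decide)
  | t021 => (pair_mem_indepPairs_top (V := Fin 6)).2 (by decide)
  | t022 => (pair_mem_indepPairs_top (V := Fin 6)).2 (by decide)
  | t01 => (pair_mem_indepPairs_top (V := Fin 7)).2 (by decide)

/-- Canonical pairs have no spare vertices, so the images of their edges determine the range of an
injection. -/
theorem vertices_pat (ω : PairType) : vertices (patFst ω) ∪ vertices (patSnd ω) = Finset.univ := by
  cases ω <;> decide

/-- `(p, r)` is the image of the canonical pair of type `ω`. -/
def IsPattern (ω : PairType) (p r : Finset (Sym2 V)) : Prop :=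
  ∃ f : Fin (patSize ω) → V, Function.Injective f ∧
    mapEdges f (patFst ω) = p ∧ mapEdges f (patSnd ω) = r

theorem IsPattern.typeOf_eq {ω : PairType} {p r : Finset (Sym2 V)} (h : IsPattern ω p r) :
    typeOf p r = ω := by
  obtain ⟨f, hf, rfl, rfl⟩ := h
  rw [typeOf_mapEdges hf, typeOf_pat]

variable [Fintype V]

/-- The edges of `r`, and their endpoints, can be ordered by their incidence with `p`. -/
theorem exists_sorted_by_incidence (p : Finset (Sym2 V)) {r : Finset (Sym2 V)}
    (hr : r ∈ indepPairs (⊤ : SimpleGraph V)) :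
    ∃ x y z w, (x ≠ y ∧ z ≠ w ∧ x ≠ z ∧ x ≠ w ∧ y ≠ z ∧ y ≠ w) ∧ r = {s(x, y), s(z, w)} ∧
      ((x ∉ vertices p ∧ y ∉ vertices p ∧ z ∉ vertices p ∧ w ∉ vertices p) ∨
      (x ∈ vertices p ∧ y ∉ vertices p ∧ z ∉ vertices p ∧ w ∉ vertices p) ∨
      (x ∈ vertices p ∧ y ∉ vertices p ∧ z ∈ vertices p ∧ w ∉ vertices p) ∨
      (x ∈ vertices p ∧ y ∈ vertices p ∧ z ∉ vertices p ∧ w ∉ vertices p) ∨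
      (x ∈ vertices p ∧ y ∈ vertices p ∧ z ∈ vertices p ∧ w ∉ vertices p) ∨
      (x ∈ vertices p ∧ y ∈ vertices p ∧ z ∈ vertices p ∧ w ∈ vertices p)) := by
  have key : ∀ e : Sym2 V, ∃ x y, e = s(x, y) ∧ ((x ∉ vertices p ∧ y ∉ vertices p) ∨
      (x ∈ vertices p ∧ y ∉ vertices p) ∨ (x ∈ vertices p ∧ y ∈ vertices p)) := by
    intro e
    induction e with | _ x y
    by_cases hx : x ∈ vertices p <;> by_cases hy : y ∈ vertices p
    · exact ⟨x, y, rfl, .inr (.inr ⟨hx, hy⟩)⟩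
    · exact ⟨x, y, rfl, .inr (.inl ⟨hx, hy⟩)⟩
    · exact ⟨y, x, Sym2.eq_swap, .inr (.inl ⟨hy, hx⟩)⟩
    · exact ⟨x, y, rfl, .inl ⟨hx, hy⟩⟩
  obtain ⟨a, b, c, d, -, hr'⟩ := mem_indepPairs.1 hr
  obtain ⟨x, y, h1, hxy⟩ := key s(a, b)
  obtain ⟨z, w, h2, hzw⟩ := key s(c, d)
  rw [h1, h2] at hr'
  subst hr'
  have h := pair_mem_indepPairs_top.1 hr
  rw [Finset.pair_comm] at hr
  have h' := pair_mem_indepPairs_top.1 hr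
  rcases hxy with ⟨hx, hy⟩ | ⟨hx, hy⟩ | ⟨hx, hy⟩ <;>
    rcases hzw with ⟨hz, hw⟩ | ⟨hz, hw⟩ | ⟨hz, hw⟩
  · exact ⟨x, y, z, w, h, rfl, by simp [*]⟩
  · exact ⟨z, w, x, y, h', Finset.pair_comm _ _, by simp [*]⟩
  · exact ⟨z, w, x, y, h', Finset.pair_comm _ _, by simp [*]⟩
  · exact ⟨x, y, z, w, h, rfl, by simp [*]⟩
  · exact ⟨x, y, z, w, h, rfl, by simp [*]⟩
  · exact ⟨z, w, x, y, h', Finset.pair_comm _ _, by simp [*]⟩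
  · exact ⟨x, y, z, w, h, rfl, by simp [*]⟩
  · exact ⟨x, y, z, w, h, rfl, by simp [*]⟩
  · exact ⟨x, y, z, w, h, rfl, by simp [*]⟩

/-- Any two pairs of independent edges are the image of a canonical pair, up to their order. -/
theorem exists_isPattern {p r : Finset (Sym2 V)} (hp : p ∈ indepPairs (⊤ : SimpleGraph V))
    (hr : r ∈ indepPairs (⊤ : SimpleGraph V)) : ∃ ω, IsPattern ω p r ∨ IsPattern ω r p := by
  obtain ⟨x, y, z, w, h, rfl, hc⟩ := exists_sorted_by_incidence p hr
  rcases hc with ⟨hx, hy, hz, hw⟩ | ⟨hx, hy, hz, hw⟩ | ⟨hx, hy, hz, hw⟩ | ⟨hx, hy, hz, hw⟩ |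
    ⟨hx, hy, hz, hw⟩ | ⟨hx, hy, hz, hw⟩
  · obtain ⟨s, t, u, v, h', rfl⟩ := mem_indepPairs.1 hp
    simp only [SimpleGraph.top_adj] at h'
    simp only [vertices_pair, Finset.mem_insert, Finset.mem_singleton] at hx hy hz hw
    exact ⟨t00, .inl ⟨(![s, t, u, v, x, y, z, w] : Fin 8 → V),
      List.nodup_ofFn.1 (by simp [List.ofFn_succ]; grind),
      mapEdges_pair _ _ _ _ _, mapEdges_pair _ _ _ _ _⟩⟩
  · obtain ⟨t, u, v, h', rfl⟩ := exists_eq_of_mem_vertices hp hx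
    simp only [SimpleGraph.top_adj] at h'
    simp only [vertices_pair, Finset.mem_insert, Finset.mem_singleton] at hy hz hw
    exact ⟨t01, .inl ⟨(![x, t, u, v, y, z, w] : Fin 7 → V),
      List.nodup_ofFn.1 (by simp [List.ofFn_succ]; grind),
      mapEdges_pair _ _ _ _ _, mapEdges_pair _ _ _ _ _⟩⟩
  · rcases exists_eq_of_mem_vertices_of_mem_vertices hp hx hz (by grind) with
      ⟨u, v, h', rfl⟩ | ⟨t, v, h', rfl⟩
    all_goals simp only [SimpleGraph.top_adj] at h'
    · simp only [vertices_pair, Finset.mem_insert, Finset.mem_singleton] at hy hw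
      -- The edge that joins the common vertices `x`, `z` lies in `p`, whereas in the canonical pair
      -- it lies in the second component. This is the only case that needs the exchanged order.
      exact ⟨t021, .inr ⟨(![x, y, z, w, u, v] : Fin 6 → V),
        List.nodup_ofFn.1 (by simp [List.ofFn_succ]; grind),
        mapEdges_pair _ _ _ _ _, mapEdges_pair _ _ _ _ _⟩⟩
    · simp only [vertices_pair, Finset.mem_insert, Finset.mem_singleton] at hy hw
      exact ⟨t022, .inl ⟨(![x, t, z, v, y, w] : Fin 6 → V),
        List.nodup_ofFn.1 (by simp [List.ofFn_succ]; grind),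
        mapEdges_pair _ _ _ _ _, mapEdges_pair _ _ _ _ _⟩⟩
  · rcases exists_eq_of_mem_vertices_of_mem_vertices hp hx hy (by grind) with
      ⟨u, v, h', rfl⟩ | ⟨t, v, h', rfl⟩
    all_goals simp only [SimpleGraph.top_adj] at h'
    · simp only [vertices_pair, Finset.mem_insert, Finset.mem_singleton] at hz hw
      exact ⟨t12, .inl ⟨(![x, y, u, v, z, w] : Fin 6 → V),
        List.nodup_ofFn.1 (by simp [List.ofFn_succ]; grind),
        mapEdges_pair _ _ _ _ _, mapEdges_pair _ _ _ _ _⟩⟩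
    · simp only [vertices_pair, Finset.mem_insert, Finset.mem_singleton] at hz hw
      exact ⟨t021, .inl ⟨(![x, t, y, v, z, w] : Fin 6 → V),
        List.nodup_ofFn.1 (by simp [List.ofFn_succ]; grind),
        mapEdges_pair _ _ _ _ _, mapEdges_pair _ _ _ _ _⟩⟩
  · rcases exists_eq_of_mem_vertices_of_mem_vertices hp hx hy (by grind) with
      ⟨u, v, h', rfl⟩ | ⟨t, v, h', rfl⟩
    all_goals simp only [SimpleGraph.top_adj] at h'
    · simp only [vertices_pair, Finset.mem_insert, Finset.mem_singleton] at hz hw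
      obtain rfl | rfl : z = u ∨ z = v := by grind
      · exact ⟨t13, .inl ⟨(![x, y, z, v, w] : Fin 5 → V),
          List.nodup_ofFn.1 (by simp [List.ofFn_succ]; grind),
          mapEdges_pair _ _ _ _ _, mapEdges_pair _ _ _ _ _⟩⟩
      · exact ⟨t13, .inl ⟨(![x, y, z, u, w] : Fin 5 → V),
          List.nodup_ofFn.1 (by simp [List.ofFn_succ]; grind),
          (mapEdges_pair _ _ _ _ _).trans (congrArg _ (congrArg _ Sym2.eq_swap)),
          mapEdges_pair _ _ _ _ _⟩⟩
    · simp only [vertices_pair, Finset.mem_insert, Finset.mem_singleton] at hz hw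
      obtain rfl | rfl : z = t ∨ z = v := by grind
      · exact ⟨t03, .inl ⟨(![y, v, x, z, w] : Fin 5 → V),
          List.nodup_ofFn.1 (by simp [List.ofFn_succ]; grind),
          (mapEdges_pair _ _ _ _ _).trans (Finset.pair_comm _ _),
          (mapEdges_pair _ _ _ _ _).trans (congrArg (insert · _) Sym2.eq_swap)⟩⟩
      · exact ⟨t03, .inl ⟨(![x, t, y, z, w] : Fin 5 → V),
          List.nodup_ofFn.1 (by simp [List.ofFn_succ]; grind),
          mapEdges_pair _ _ _ _ _, mapEdges_pair _ _ _ _ _⟩⟩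
  · rcases exists_eq_of_mem_vertices_of_mem_vertices hp hx hy (by grind) with
      ⟨u, v, h', rfl⟩ | ⟨t, v, h', rfl⟩
    all_goals simp only [SimpleGraph.top_adj] at h'
    · simp only [vertices_pair, Finset.mem_insert, Finset.mem_singleton] at hz hw
      obtain ⟨rfl, rfl⟩ | ⟨rfl, rfl⟩ : (z = u ∧ w = v) ∨ (z = v ∧ w = u) := by grind
      · exact ⟨t24, .inl ⟨(![x, y, z, w] : Fin 4 → V),
          List.nodup_ofFn.1 (by simp [List.ofFn_succ]; grind),
          mapEdges_pair _ _ _ _ _, mapEdges_pair _ _ _ _ _⟩⟩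
      · exact ⟨t24, .inl ⟨(![x, y, z, w] : Fin 4 → V),
          List.nodup_ofFn.1 (by simp [List.ofFn_succ]; grind),
          (mapEdges_pair _ _ _ _ _).trans (congrArg _ (congrArg _ Sym2.eq_swap)),
          mapEdges_pair _ _ _ _ _⟩⟩
    · simp only [vertices_pair, Finset.mem_insert, Finset.mem_singleton] at hz hw
      obtain ⟨rfl, rfl⟩ | ⟨rfl, rfl⟩ : (z = t ∧ w = v) ∨ (z = v ∧ w = t) := by grind
      · exact ⟨t04, .inl ⟨(![x, z, y, w] : Fin 4 → V),
          List.nodup_ofFn.1 (by simp [List.ofFn_succ]; grind),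
          mapEdges_pair _ _ _ _ _, mapEdges_pair _ _ _ _ _⟩⟩
      · exact ⟨t04, .inl ⟨(![x, w, y, z] : Fin 4 → V),
          List.nodup_ofFn.1 (by simp [List.ofFn_succ]; grind),
          mapEdges_pair _ _ _ _ _,
          (mapEdges_pair _ _ _ _ _).trans (congrArg _ (congrArg _ Sym2.eq_swap))⟩⟩

theorem isPattern_typeOf {p r : Finset (Sym2 V)} (hp : p ∈ indepPairs (⊤ : SimpleGraph V))
    (hr : r ∈ indepPairs (⊤ : SimpleGraph V)) :
    IsPattern (typeOf p r) p r ∨ IsPattern (typeOf p r) r p := by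
  obtain ⟨ω, h | h⟩ := exists_isPattern hp hr
  · exact .inl (h.typeOf_eq.symm ▸ h)
  · exact .inr (by rw [typeOf_comm]; exact h.typeOf_eq.symm ▸ h)

end Patterns

/-! ### Embedding counts with degree weights, and how to remove the weights -/

section EmbeddingSums

variable {V : Type*} [Fintype V] [DecidableEq V]

/-- A sum over the embeddings of `Fin n` and all vertices splits according to whether the vertex
belongs to the range of the embedding. -/
theorem sum_embedding_sum {n : ℕ} (g : (Fin n → V) → V → ℝ) :
    ∑ f : Fin n ↪ V, ∑ w, g f w = ∑ f : Fin n ↪ V, ∑ i, g f (f i)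
      + ∑ f : Fin (n + 1) ↪ V, g (f ∘ Fin.castSucc) (f (Fin.last n)) := by
  have h1 : ∀ f : Fin n ↪ V, ∑ w, g f w
      = ∑ i, g f (f i) + ∑ w ∈ (Finset.univ.image f)ᶜ, g f w := by
    intro f
    rw [← Finset.sum_add_sum_compl (Finset.univ.image f), Finset.sum_image f.injective.injOn]
  rw [Finset.sum_congr rfl fun f _ => h1 f, Finset.sum_add_distrib]
  congr 1
  rw [Finset.sum_sigma']
  refine Finset.sum_bij' (fun x hx => Fin.Embedding.snoc x.1 (a := x.2) (by simpa using hx))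
    (fun f _ => ⟨Fin.Embedding.init f, f (Fin.last n)⟩) ?_ ?_ ?_ ?_ ?_
  · simp
  · intro f _
    simp only [Finset.mem_sigma, Finset.mem_univ, Finset.mem_compl, Finset.mem_image, true_and,
      not_exists]
    intro i hi
    exact absurd (f.injective hi) (Fin.castSucc_lt_last i).ne
  · rintro ⟨f, w⟩ hx
    simp [Fin.Embedding.init_snoc]
  · intro f _
    ext i
    refine Fin.lastCases ?_ (fun j => ?_) i
    · simp
    · rw [Fin.Embedding.snoc_castSucc]
      rfl
  · rintro ⟨f, w⟩ hx
    have : (Fin.snoc f w : Fin (n + 1) → V) ∘ Fin.castSucc = f := by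
      ext i; simp
    simp [this]

theorem sum_embedding_reindex {n : ℕ} (g : Fin n → Fin n) (hg : Function.Injective g)
    (F : (Fin n → V) → ℝ) : ∑ f : Fin n ↪ V, F (f ∘ g) = ∑ f : Fin n ↪ V, F f :=
  Fintype.sum_equiv
    (Equiv.embeddingCongr (Equiv.ofBijective g (Finite.injective_iff_bijective.1 hg)).symm
      (Equiv.refl V)) _ _ fun f => by
    congr 1

variable (G : SimpleGraph V) [DecidableRel G.Adj]

/-- The indicator that `f` maps the edges in `E` to edges of `G`. -/
noncomputable def edgeInd {n : ℕ} (E : Finset (Sym2 (Fin n))) (f : Fin n → V) : ℝ :=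
  if mapEdges f E ⊆ G.edgeFinset then 1 else 0

/-- The number of embeddings that map the edges in `E` to edges of `G`. -/
noncomputable def embCount {n : ℕ} (E : Finset (Sym2 (Fin n))) : ℝ := ∑ f : Fin n ↪ V, edgeInd G E f

/-- The embeddings that map the edges in `E` to edges of `G`, weighted by the degree of the image
of `i`. -/
noncomputable def embDeg {n : ℕ} (E : Finset (Sym2 (Fin n))) (i : Fin n) : ℝ :=
  ∑ f : Fin n ↪ V, k G (f i) * edgeInd G E f

/-- The embeddings that map the edges in `E` to edges of `G`, weighted by the product of the degrees
of the images of `i` and `j`. -/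
noncomputable def embDegDeg {n : ℕ} (E : Finset (Sym2 (Fin n))) (i j : Fin n) : ℝ :=
  ∑ f : Fin n ↪ V, k G (f i) * (k G (f j) * edgeInd G E f)

variable {G}

theorem a_eq (u v : V) : a G u v = if G.Adj u v then 1 else 0 := by
  simp [a, SimpleGraph.adjMatrix_apply]

theorem k_eq_sum (v : V) : k G v = ∑ w, a G v w := by
  simp [k, a_eq, SimpleGraph.card_neighborFinset_eq_degree, ← SimpleGraph.neighborFinset_eq_filter]

theorem two_mul_m : 2 * m G = ∑ v, k G v := by
  simp only [m, k]
  exact_mod_cast (G.sum_degrees_eq_twice_card_edges).symm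

theorem edgeInd_insert {n : ℕ} (E : Finset (Sym2 (Fin n))) (i j : Fin n) (f : Fin n → V) :
    edgeInd G (insert s(i, j) E) f = a G (f i) (f j) * edgeInd G E f := by
  simp only [edgeInd, a_eq, mapEdges, Finset.image_insert, Finset.insert_subset_iff, Sym2.map_mk,
    SimpleGraph.mem_edgeFinset, SimpleGraph.mem_edgeSet, ite_and]
  split_ifs <;> simp_all

theorem edgeInd_empty {n : ℕ} (f : Fin n → V) : edgeInd G ∅ f = 1 := by
  simp [edgeInd, mapEdges]

theorem edgeInd_mapEdges {n l : ℕ} (g : Fin l → Fin n) (E : Finset (Sym2 (Fin l)))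
    (f : Fin n → V) : edgeInd G (mapEdges g E) f = edgeInd G E (f ∘ g) := by
  simp [edgeInd, mapEdges_mapEdges]

theorem embCount_reindex {n : ℕ} {E E' : Finset (Sym2 (Fin n))} (g : Fin n → Fin n)
    (hg : Function.Injective g) (h : mapEdges g E = E') : embCount G E = embCount G E' := by
  simp only [embCount, ← h, edgeInd_mapEdges]
  exact (sum_embedding_reindex g hg _).symm

theorem embDeg_reindex {n : ℕ} {E E' : Finset (Sym2 (Fin n))} {i i' : Fin n} (g : Fin n → Fin n)
    (hg : Function.Injective g) (h : mapEdges g E = E') (hi : g i = i') :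
    embDeg G E i = embDeg G E' i' := by
  simp only [embDeg, ← h, edgeInd_mapEdges, ← hi]
  exact (sum_embedding_reindex g hg fun f => k G (f i) * edgeInd G E f).symm

theorem embDegDeg_reindex {n : ℕ} {E E' : Finset (Sym2 (Fin n))} {i i' j j' : Fin n}
    (g : Fin n → Fin n) (hg : Function.Injective g) (h : mapEdges g E = E') (hi : g i = i')
    (hj : g j = j') : embDegDeg G E i j = embDegDeg G E' i' j' := by
  simp only [embDegDeg, ← h, edgeInd_mapEdges, ← hi, ← hj]
  exact (sum_embedding_reindex g hg fun f => k G (f i) * (k G (f j) * edgeInd G E f)).symm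

/-- There are no loops in `G`; this disposes of the term `j = i` when a degree at `i` is expanded.
-/
theorem embCount_of_isDiag {n : ℕ} {E : Finset (Sym2 (Fin n))} (i : Fin n)
    (h : s(i, i) ∈ E) : embCount G E = 0 := by
  rw [embCount, ← Finset.insert_eq_of_mem h]
  simp [edgeInd_insert, a_eq]

theorem embDeg_of_isDiag {n : ℕ} {E : Finset (Sym2 (Fin n))} (i j : Fin n)
    (h : s(i, i) ∈ E) : embDeg G E j = 0 := by
  rw [embDeg, ← Finset.insert_eq_of_mem h]
  simp [edgeInd_insert, a_eq]

theorem sum_degree_mul {n : ℕ} (i : Fin n) (F : (Fin n → V) → ℝ) :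
    ∑ f : Fin n ↪ V, k G (f i) * F f
      = ∑ j, ∑ f : Fin n ↪ V, a G (f i) (f j) * F f
        + ∑ f : Fin (n + 1) ↪ V, a G (f i.castSucc) (f (Fin.last n)) * F (f ∘ Fin.castSucc) := by
  simp only [k_eq_sum, Finset.sum_mul]
  rw [sum_embedding_sum fun f w => a G (f i) w * F f,
    Finset.sum_comm (s := Finset.univ (α := Fin n))]
  rfl

/-- The neighbours of `f i` that are values `f j` contribute a chord `ij` (no new edge if `ij` is
already in `E`), the others extend `f` by a vertex pendant at `i`. -/
theorem embDeg_eq {n : ℕ} (E : Finset (Sym2 (Fin n))) (i : Fin n) :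
    embDeg G E i = ∑ j, embCount G (insert s(i, j) E)
      + embCount G (insert s(i.castSucc, Fin.last n) (mapEdges Fin.castSucc E)) := by
  simp only [embDeg, embCount, edgeInd_insert, edgeInd_mapEdges]
  exact sum_degree_mul i (edgeInd G E)

/-- Only the degree at `i` is expanded; the weight at `j` is carried along to the enlarged patterns.
-/
theorem embDegDeg_eq {n : ℕ} (E : Finset (Sym2 (Fin n))) (i j : Fin n) :
    embDegDeg G E i j = ∑ l, embDeg G (insert s(i, l) E) j
      + embDeg G (insert s(i.castSucc, Fin.last n) (mapEdges Fin.castSucc E)) j.castSucc := by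
  simp only [embDegDeg, embDeg, edgeInd_insert, edgeInd_mapEdges]
  rw [sum_degree_mul i fun f => k G (f j) * edgeInd G E f]
  congr 1
  · exact Finset.sum_congr rfl fun l _ => Finset.sum_congr rfl fun f _ => by ring
  · exact Finset.sum_congr rfl fun f _ => by simp only [Function.comp]; ring

/-- By the handshake lemma `2m` is a sum of degrees over all vertices. A vertex outside the range of
the embedding becomes a new isolated vertex of the pattern, which carries the weight. -/
theorem two_mul_m_mul_embCount {n : ℕ} (E : Finset (Sym2 (Fin n))) :
    2 * m G * embCount G E = ∑ j, embDeg G E j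
      + embDeg G (mapEdges Fin.castSucc E) (Fin.last n) := by
  simp only [embDeg, embCount, edgeInd_mapEdges, two_mul_m]
  rw [Finset.mul_sum]
  simp only [Finset.sum_mul]
  rw [sum_embedding_sum fun f w => k G w * edgeInd G E f,
    Finset.sum_comm (s := Finset.univ (α := Fin n))]

end EmbeddingSums

/-! ### From frequencies to embedding counts: symmetries of the canonical pairs -/

section Symmetry

variable {V : Type*} [Fintype V] [DecidableEq V]

/-- Embeddings with values in the range of `f` are the `f ∘ σ`, each for a single `σ`. Counting them
becomes a problem inside `Fin n`, independent of `V`, that can be decided. -/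
theorem card_embedding_eq_card_perm {n : ℕ} (f : Fin n ↪ V) (P : (Fin n → V) → Prop)
    [DecidablePred P] (h : ∀ g : Fin n ↪ V, P g → ∀ i, ∃ j, f j = g i) :
    (Finset.univ.filter fun g : Fin n ↪ V => P g).card
      = (Finset.univ.filter fun σ : Equiv.Perm (Fin n) => P (f ∘ σ)).card := by
  symm
  refine Finset.card_bij (fun σ _ => σ.toEmbedding.trans f) ?_ ?_ ?_
  · intro σ hσ
    exact Finset.mem_filter.2 ⟨Finset.mem_univ _, (Finset.mem_filter.1 hσ).2⟩
  · intro σ _ τ _ hστ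
    ext i
    have := DFunLike.congr_fun hστ i
    exact congrArg Fin.val (f.injective this)
  · intro g hg
    choose j hj using h g (by simpa using hg)
    have hinj : Function.Injective j := fun x y hxy => g.injective (by rw [← hj x, ← hj y, hxy])
    refine ⟨Equiv.ofBijective j (Finite.injective_iff_bijective.1 hinj), ?_, ?_⟩
    · have h2 : f ∘ (Equiv.ofBijective j (Finite.injective_iff_bijective.1 hinj)) = g := by
        ext i; exact hj i
      exact Finset.mem_filter.2 ⟨Finset.mem_univ _, h2 ▸ (Finset.mem_filter.1 hg).2⟩
    · ext i; exact hj i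

theorem exists_eq_of_mapEdges_eq {n : ℕ} {E : Finset (Sym2 (Fin n))} (hE : vertices E = Finset.univ)
    {f g : Fin n → V} {E' : Finset (Sym2 (Fin n))} (h : mapEdges g E = mapEdges f E') (i : Fin n) :
    ∃ j, f j = g i := by
  have h1 := congrArg vertices h
  rw [vertices_mapEdges, vertices_mapEdges, hE] at h1
  have h2 : g i ∈ (vertices E').image f := h1 ▸ Finset.mem_image_of_mem g (Finset.mem_univ i)
  obtain ⟨j, -, hj⟩ := Finset.mem_image.1 h2
  exact ⟨j, hj⟩

variable (G : SimpleGraph V) [DecidableRel G.Adj]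

theorem embCount_eq_card {n : ℕ} (E : Finset (Sym2 (Fin n))) : embCount G E
    = (Finset.univ.filter fun f : Fin n ↪ V => mapEdges f E ⊆ G.edgeFinset).card := by
  simp [embCount, edgeInd]

theorem vertices_union (p r : Finset (Sym2 V)) : vertices (p ∪ r) = vertices p ∪ vertices r := by
  simp [vertices, Finset.union_biUnion]

theorem mapEdges_union {W : Type*} [DecidableEq W] (f : W → V) (p r : Finset (Sym2 W)) :
    mapEdges f (p ∪ r) = mapEdges f p ∪ mapEdges f r := Finset.image_union _ _

/-- The number of symmetries of the canonical pair, including those that exchange its components. -/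
def patSymm (ω : PairType) : ℕ :=
  (Finset.univ.filter fun σ : Equiv.Perm (Fin (patSize ω)) =>
    mapEdges σ (patFst ω) = patFst ω ∧ mapEdges σ (patSnd ω) = patSnd ω).card
  + (Finset.univ.filter fun σ : Equiv.Perm (Fin (patSize ω)) =>
    mapEdges σ (patFst ω) = patSnd ω ∧ mapEdges σ (patSnd ω) = patFst ω).card

theorem card_embedding_pat (ω : PairType) (f : Fin (patSize ω) ↪ V) :
    (Finset.univ.filter fun g : Fin (patSize ω) ↪ V => mapEdges g (patFst ω) = mapEdges f (patFst ω)
        ∧ mapEdges g (patSnd ω) = mapEdges f (patSnd ω)).card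
      + (Finset.univ.filter fun g : Fin (patSize ω) ↪ V =>
        mapEdges g (patFst ω) = mapEdges f (patSnd ω)
        ∧ mapEdges g (patSnd ω) = mapEdges f (patFst ω)).card = patSymm ω := by
  have hv := vertices_pat ω
  rw [← vertices_union] at hv
  rw [card_embedding_eq_card_perm f (fun g => mapEdges g (patFst ω) = mapEdges f (patFst ω)
      ∧ mapEdges g (patSnd ω) = mapEdges f (patSnd ω)),
    card_embedding_eq_card_perm f (fun g => mapEdges g (patFst ω) = mapEdges f (patSnd ω)
      ∧ mapEdges g (patSnd ω) = mapEdges f (patFst ω)), patSymm]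
  · simp only [← mapEdges_mapEdges, (mapEdges_injective f.injective).eq_iff]
  · intro g hg
    refine exists_eq_of_mapEdges_eq hv (E' := patFst ω ∪ patSnd ω) ?_
    rw [mapEdges_union, mapEdges_union, hg.1, hg.2, Finset.union_comm]
  · intro g hg
    refine exists_eq_of_mapEdges_eq hv (E' := patFst ω ∪ patSnd ω) ?_
    rw [mapEdges_union, mapEdges_union, hg.1, hg.2]

theorem mapEdges_pat_mem_indepPairs {ω : PairType} (f : Fin (patSize ω) ↪ V) :
    (mapEdges f (patFst ω) ∈ indepPairs G ∧ mapEdges f (patSnd ω) ∈ indepPairs G) ↔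
      mapEdges f (patFst ω ∪ patSnd ω) ⊆ G.edgeFinset := by
  rw [mapEdges_union, Finset.union_subset_iff, mem_indepPairs_iff_subset (G := G),
    mem_indepPairs_iff_subset (G := G)]
  have h1 := mapEdges_mem_indepPairs_top f.injective (patFst_mem ω)
  have h2 := mapEdges_mem_indepPairs_top f.injective (patSnd_mem ω)
  tauto

/-- Each embedding of the pattern yields an ordered pair and its reverse, both of type `ω`; hence
the factor `2`. Over a given `(p, r)` the two fibres have `patSymm ω` elements in total, whichever
of the two orders is the image of the canonical pair. Treating both orders at once is necessary
because they need not be equivalent, as for `t021`. -/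
theorem patSymm_mul_freq (ω : PairType) :
    patSymm ω * freq G ω = 2 * embCount G (patFst ω ∪ patSnd ω) := by
  set Y := (indepPairs G ×ˢ indepPairs G).filter fun x => typeOf x.1 x.2 = ω with hY
  set X := Finset.univ.filter fun f : Fin (patSize ω) ↪ V =>
    mapEdges f (patFst ω ∪ patSnd ω) ⊆ G.edgeFinset with hX
  have memX : ∀ f, f ∈ X ↔ mapEdges f (patFst ω) ∈ indepPairs G ∧
      mapEdges f (patSnd ω) ∈ indepPairs G := by
    intro f
    rw [mapEdges_pat_mem_indepPairs]
    simp [hX]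
  have memY : ∀ y, y ∈ Y ↔ (y.1 ∈ indepPairs G ∧ y.2 ∈ indepPairs G) ∧ typeOf y.1 y.2 = ω := by
    intro y; simp [hY]
  have typ : ∀ f : Fin (patSize ω) ↪ V,
      typeOf (mapEdges f (patFst ω)) (mapEdges f (patSnd ω)) = ω := fun f => by
    rw [typeOf_mapEdges f.injective, typeOf_pat]
  have h1 : X.card = ∑ y ∈ Y, (X.filter fun f : Fin (patSize ω) ↪ V =>
      (mapEdges f (patFst ω), mapEdges f (patSnd ω)) = y).card :=
    Finset.card_eq_sum_card_fiberwise
      (f := fun f : Fin (patSize ω) ↪ V => (mapEdges f (patFst ω), mapEdges f (patSnd ω)))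
      fun f hf => (memY _).2 ⟨(memX f).1 hf, typ f⟩
  have h2 : X.card = ∑ y ∈ Y, (X.filter fun f : Fin (patSize ω) ↪ V =>
      (mapEdges f (patSnd ω), mapEdges f (patFst ω)) = y).card :=
    Finset.card_eq_sum_card_fiberwise
      (f := fun f : Fin (patSize ω) ↪ V => (mapEdges f (patSnd ω), mapEdges f (patFst ω)))
      fun f hf => (memY _).2 ⟨((memX f).1 hf).symm, (typeOf_comm _ _).trans (typ f)⟩
  have h3 : ∀ y ∈ Y, (X.filter fun f : Fin (patSize ω) ↪ V =>
        (mapEdges f (patFst ω), mapEdges f (patSnd ω)) = y).card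
      + (X.filter fun f : Fin (patSize ω) ↪ V =>
        (mapEdges f (patSnd ω), mapEdges f (patFst ω)) = y).card
      = patSymm ω := by
    rintro ⟨p, r⟩ hy
    obtain ⟨⟨hp, hr⟩, ht⟩ := (memY _).1 hy
    simp only at hp hr ht
    have e1 : (X.filter fun f : Fin (patSize ω) ↪ V =>
        (mapEdges f (patFst ω), mapEdges f (patSnd ω)) = (p, r))
        = Finset.univ.filter fun f : Fin (patSize ω) ↪ V =>
          mapEdges f (patFst ω) = p ∧ mapEdges f (patSnd ω) = r := by
      ext f
      simp only [Finset.mem_filter, memX, Prod.mk.injEq, Finset.mem_univ, true_and]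
      exact ⟨fun h => h.2, fun h => ⟨⟨h.1 ▸ hp, h.2 ▸ hr⟩, h⟩⟩
    have e2 : (X.filter fun f : Fin (patSize ω) ↪ V =>
        (mapEdges f (patSnd ω), mapEdges f (patFst ω)) = (p, r))
        = Finset.univ.filter fun f : Fin (patSize ω) ↪ V =>
          mapEdges f (patFst ω) = r ∧ mapEdges f (patSnd ω) = p := by
      ext f
      simp only [Finset.mem_filter, memX, Prod.mk.injEq, Finset.mem_univ, true_and]
      exact ⟨fun h => h.2.symm, fun h => ⟨⟨h.1 ▸ hr, h.2 ▸ hp⟩, h.symm⟩⟩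
    rw [e1, e2]
    rcases ht ▸ isPattern_typeOf (mem_indepPairs_iff_subset.1 hp).1
      (mem_indepPairs_iff_subset.1 hr).1 with ⟨f, hf, rfl, rfl⟩ | ⟨f, hf, rfl, rfl⟩
    · exact card_embedding_pat ω ⟨f, hf⟩
    · rw [add_comm]
      exact card_embedding_pat ω ⟨f, hf⟩
  have h4 : patSymm ω * Y.card = 2 * X.card := by
    rw [two_mul]
    nth_rewrite 1 [h1]
    rw [h2, ← Finset.sum_add_distrib, Finset.sum_congr rfl h3, Finset.sum_const, smul_eq_mul,
      mul_comm]
  rw [embCount_eq_card, freq]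
  exact_mod_cast h4

theorem patSymm_t24 : patSymm t24 = 16 := by decide +kernel
theorem patSymm_t13 : patSymm t13 = 4 := by decide +kernel
theorem patSymm_t12 : patSymm t12 = 16 := by decide +kernel
theorem patSymm_t04 : patSymm t04 = 8 := by decide +kernel
theorem patSymm_t03 : patSymm t03 = 2 := by decide +kernel
-- The components cannot be exchanged: the first one holds both end edges of the path on four
-- vertices, the second one its middle edge. The symmetries are generated by the reversal of the
-- path and the flip of the isolated edge.
theorem patSymm_t021 : patSymm t021 = 4 := by decide +kernel
theorem patSymm_t022 : patSymm t022 = 4 := by decide +kernel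

end Symmetry

/-! ### The small graphs that occur -/

section EdgeSets

/-- The edges of an edge. -/
abbrev edgesL2 : Finset (Sym2 (Fin 2)) := {s(0, 1)}

/-- The edges of the path on three vertices. -/
abbrev edgesL3 : Finset (Sym2 (Fin 3)) := {s(0, 1), s(1, 2)}

/-- The edges of two disjoint edges. -/
abbrev edges2L2 : Finset (Sym2 (Fin 4)) := {s(0, 1), s(2, 3)}

/-- The edges of the path on four vertices. -/
abbrev edgesL4 : Finset (Sym2 (Fin 4)) := {s(0, 1), s(1, 2), s(2, 3)}

/-- The edges of the cycle on four vertices. -/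
abbrev edgesC4 : Finset (Sym2 (Fin 4)) := {s(0, 1), s(1, 2), s(2, 3), s(3, 0)}

/-- The edges of the paw. -/
abbrev edgesPaw : Finset (Sym2 (Fin 4)) := {s(0, 1), s(1, 2), s(0, 2), s(2, 3)}

/-- The edges of the path on five vertices. -/
abbrev edgesL5 : Finset (Sym2 (Fin 5)) := {s(0, 1), s(1, 2), s(2, 3), s(3, 4)}

/-- The edges of the disjoint union of a triangle and an edge. -/
abbrev edgesC3L2 : Finset (Sym2 (Fin 5)) := {s(0, 1), s(1, 2), s(0, 2), s(3, 4)}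

/-- The edges of the tree with degrees `3, 2, 1, 1, 1`. -/
abbrev edgesFork : Finset (Sym2 (Fin 5)) := {s(0, 1), s(1, 2), s(2, 3), s(1, 4)}

/-- The edges of the disjoint union of an edge and a path on three vertices. -/
abbrev edgesL2L3 : Finset (Sym2 (Fin 5)) := {s(0, 1), s(2, 3), s(2, 4)}

/-- The edges of three disjoint edges. -/
abbrev edges3L2 : Finset (Sym2 (Fin 6)) := {s(0, 1), s(2, 3), s(4, 5)}

/-- The edges of the disjoint union of a path on four vertices and an edge. -/
abbrev edgesL4L2 : Finset (Sym2 (Fin 6)) := {s(0, 1), s(2, 3), s(0, 2), s(4, 5)}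

/-- The edges of two disjoint paths on three vertices. -/
abbrev edges2L3 : Finset (Sym2 (Fin 6)) := {s(0, 1), s(2, 3), s(0, 4), s(2, 5)}

end EdgeSets

/-! ### Subgraph counts as embedding counts -/

section CopyCount

variable {V : Type*} [Fintype V] [DecidableEq V] (G : SimpleGraph V)

theorem copyCount_congr {W W' : Type*} {H : SimpleGraph W} {H' : SimpleGraph W'} (e : H ≃g H') :
    G.copyCount H = G.copyCount H' := by
  classical
  unfold SimpleGraph.copyCount
  congr 1
  ext K
  simp only [Finset.mem_filter, Finset.mem_univ, true_and]
  exact ⟨fun ⟨i⟩ => ⟨e.symm.trans i⟩, fun ⟨i⟩ => ⟨e.trans i⟩⟩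

variable {G}

theorem edgeSet_toSubgraph {W : Type*} {H : SimpleGraph W} (f : H.Copy G) :
    f.toSubgraph.edgeSet = Sym2.map f '' H.edgeSet := by
  simp [SimpleGraph.Copy.toSubgraph, SimpleGraph.Subgraph.edgeSet_map]

theorem mem_edgeSet_fromEdgeSet {n : ℕ} {E : Finset (Sym2 (Fin n))} (hd : ∀ e ∈ E, ¬ e.IsDiag) :
    (SimpleGraph.fromEdgeSet (E : Set (Sym2 (Fin n)))).edgeSet = E := by
  rw [SimpleGraph.edgeSet_fromEdgeSet]
  ext e
  simp only [Set.mem_sdiff, Finset.mem_coe]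
  exact ⟨fun h => h.1, fun h => ⟨h, hd e h⟩⟩

/-- Without isolated vertices, a subgraph is determined by its edges. -/
theorem toSubgraph_eq_iff {n : ℕ} {E : Finset (Sym2 (Fin n))} (hd : ∀ e ∈ E, ¬ e.IsDiag)
    (hv : vertices E = Finset.univ)
    (f g : (SimpleGraph.fromEdgeSet (E : Set (Sym2 (Fin n)))).Copy G) :
    f.toSubgraph = g.toSubgraph ↔ mapEdges f E = mapEdges g E := by
  have hE : ∀ h : (SimpleGraph.fromEdgeSet (E : Set (Sym2 (Fin n)))).Copy G,
      h.toSubgraph.edgeSet = (mapEdges h E : Set (Sym2 V)) := by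
    intro h
    rw [edgeSet_toSubgraph, mem_edgeSet_fromEdgeSet hd, mapEdges, Finset.coe_image]
  constructor
  · intro h
    apply Finset.coe_injective
    rw [← hE, ← hE, h]
  · intro h
    have h1 : f.toSubgraph.edgeSet = g.toSubgraph.edgeSet := by rw [hE, hE, h]
    have h2 : Set.range f = Set.range g := by
      have := congrArg vertices h
      rw [vertices_mapEdges, vertices_mapEdges, hv] at this
      have := congrArg (fun s : Finset V => (s : Set V)) this
      simpa using this
    ext x y
    · simpa using Set.ext_iff.1 h2 x
    · rw [← SimpleGraph.Subgraph.mem_edgeSet, ← SimpleGraph.Subgraph.mem_edgeSet, h1]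

/-- The embeddings of a graph are its copies, counted with the automorphisms. -/
theorem copyCount_mul_card [DecidableRel G.Adj] {n : ℕ} {E : Finset (Sym2 (Fin n))}
    (hd : ∀ e ∈ E, ¬ e.IsDiag) (hv : vertices E = Finset.univ) :
    (G.copyCount (SimpleGraph.fromEdgeSet (E : Set (Sym2 (Fin n)))) : ℝ) *
      (Finset.univ.filter fun σ : Equiv.Perm (Fin n) => mapEdges σ E = E).card
      = embCount G E := by
  classical
  set H := SimpleGraph.fromEdgeSet (E : Set (Sym2 (Fin n))) with hH
  have hhom : ∀ f : Fin n → V, mapEdges f E ⊆ G.edgeFinset ↔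
      ∀ i j, H.Adj i j → G.Adj (f i) (f j) := by
    intro f
    simp only [mapEdges, Finset.image_subset_iff, SimpleGraph.mem_edgeFinset, Sym2.forall,
      Sym2.map_mk, SimpleGraph.mem_edgeSet, hH, SimpleGraph.fromEdgeSet_adj, Finset.mem_coe]
    exact ⟨fun h i j hij => h i j hij.1, fun h i j hij => h i j ⟨hij, fun e => hd _ hij e⟩⟩
  let toEmb : H.Copy G ≃ {f : Fin n ↪ V // mapEdges f E ⊆ G.edgeFinset} :=
    { toFun := fun c => ⟨c.toEmbedding, (hhom _).2 fun i j h => c.toHom.map_adj h⟩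
      invFun := fun f => ⟨⟨f.1, fun {i j} h => (hhom _).1 f.2 i j h⟩, f.1.injective⟩
      left_inv := fun c => rfl
      right_inv := fun f => rfl }
  have h1 : embCount G E = Fintype.card (H.Copy G) := by
    rw [embCount_eq_card, Fintype.card_congr toEmb, Fintype.card_subtype]
  -- Copies with the same image differ by a permutation that preserves `E`, so all the fibres of
  -- `toSubgraph` have the order of the automorphism group as their size.
  have h2 : ∀ c : H.Copy G,
      (Finset.univ.filter fun c' : H.Copy G => c'.toSubgraph = c.toSubgraph).card
      = (Finset.univ.filter fun σ : Equiv.Perm (Fin n) => mapEdges σ E = E).card := by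
    intro c
    have h3 := card_embedding_eq_card_perm c.toEmbedding (fun g => mapEdges g E = mapEdges c E)
      fun g hg => exists_eq_of_mapEdges_eq hv hg
    have h4 : ∀ σ : Equiv.Perm (Fin n),
        mapEdges (c.toEmbedding ∘ σ) E = mapEdges c E ↔ mapEdges σ E = E := by
      intro σ
      rw [← mapEdges_mapEdges]
      exact (mapEdges_injective c.toEmbedding.injective).eq_iff
    simp only [h4] at h3
    rw [← h3]
    refine Finset.card_bij (fun c' _ => c'.toEmbedding) ?_ ?_ ?_
    · intro c' hc'
      refine Finset.mem_filter.2 ⟨Finset.mem_univ _, ?_⟩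
      exact (toSubgraph_eq_iff hd hv c' c).1 (Finset.mem_filter.1 hc').2
    · intro c₁ _ c₂ _ h
      exact SimpleGraph.Copy.ext fun i => DFunLike.congr_fun h i
    · intro g hg
      have hg' : mapEdges g E = mapEdges c E := (Finset.mem_filter.1 hg).2
      have hg2 : mapEdges g E ⊆ G.edgeFinset := hg' ▸ (toEmb c).2
      refine ⟨toEmb.symm ⟨g, hg2⟩, ?_, rfl⟩
      exact Finset.mem_filter.2 ⟨Finset.mem_univ _, (toSubgraph_eq_iff hd hv _ c).2 hg'⟩
  rw [h1, SimpleGraph.copyCount_eq_card_image_copyToSubgraph, ← Finset.card_univ,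
    Finset.card_eq_sum_card_image (SimpleGraph.Copy.toSubgraph (A := H) (B := G)) Finset.univ,
    Finset.sum_congr rfl (g := fun _ =>
      (Finset.univ.filter fun σ : Equiv.Perm (Fin n) => mapEdges σ E = E).card),
    Finset.sum_const, smul_eq_mul]
  · push_cast
    rfl
  · intro K hK
    obtain ⟨c, -, rfl⟩ := Finset.mem_image.1 hK
    exact h2 c

variable (G) [DecidableRel G.Adj]

theorem pathGraph_two : SimpleGraph.pathGraph 2
    = SimpleGraph.fromEdgeSet (edgesL2 : Set (Sym2 (Fin 2))) := by
  ext i j; revert i j; simp only [SimpleGraph.pathGraph_adj]; decide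

theorem pathGraph_three : SimpleGraph.pathGraph 3
    = SimpleGraph.fromEdgeSet (edgesL3 : Set (Sym2 (Fin 3))) := by
  ext i j; revert i j; simp only [SimpleGraph.pathGraph_adj]; decide

theorem pathGraph_four : SimpleGraph.pathGraph 4
    = SimpleGraph.fromEdgeSet (edgesL4 : Set (Sym2 (Fin 4))) := by
  ext i j; revert i j; simp only [SimpleGraph.pathGraph_adj]; decide

theorem pathGraph_five : SimpleGraph.pathGraph 5
    = SimpleGraph.fromEdgeSet (edgesL5 : Set (Sym2 (Fin 5))) := by
  ext i j; revert i j; simp only [SimpleGraph.pathGraph_adj]; decide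

theorem cycleGraph_four : SimpleGraph.cycleGraph 4
    = SimpleGraph.fromEdgeSet (edgesC4 : Set (Sym2 (Fin 4))) := by
  ext i j; revert i j; decide

theorem pawGraph_eq : pawGraph
    = SimpleGraph.fromEdgeSet (edgesPaw : Set (Sym2 (Fin 4))) := by
  simp [pawGraph]

/-- The disjoint union of a triangle and an edge, as a graph on `Fin 5`. -/
def triangleEdgeIso : SimpleGraph.cycleGraph 3 ⊕g SimpleGraph.pathGraph 2 ≃g
    SimpleGraph.fromEdgeSet (edgesC3L2 : Set (Sym2 (Fin 5))) where
  toEquiv := finSumFinEquiv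
  map_rel_iff' := by
    rintro (i | i) (j | j)
    · simp only [SimpleGraph.sum_adj]; revert i j; decide
    · simp only [SimpleGraph.sum_adj]; revert i j; decide
    · simp only [SimpleGraph.sum_adj]; revert i j; decide
    · simp only [SimpleGraph.sum_adj, SimpleGraph.pathGraph_adj]; revert i j; decide

/-- Here and in the next six results the factor is the order of the automorphism group of the graph.
-/
theorem two_mul_nL_two : 2 * nL G 2 = embCount G edgesL2 := by
  have h : (Finset.univ.filter fun σ : Equiv.Perm (Fin 2) =>
      mapEdges σ edgesL2 = edgesL2).card = 2 := by
    decide +kernel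
  rw [nL, pathGraph_two, ← copyCount_mul_card (by decide) (by decide), h, mul_comm]
  norm_num

theorem two_mul_nL_three :
    2 * nL G 3 = embCount G edgesL3 := by
  have h : (Finset.univ.filter fun σ : Equiv.Perm (Fin 3) =>
      mapEdges σ edgesL3 = edgesL3).card = 2 := by
    decide +kernel
  rw [nL, pathGraph_three, ← copyCount_mul_card (by decide) (by decide), h, mul_comm]
  norm_num

theorem two_mul_nL_four :
    2 * nL G 4 = embCount G edgesL4 := by
  have h : (Finset.univ.filter fun σ : Equiv.Perm (Fin 4) =>
      mapEdges σ edgesL4 = edgesL4).card = 2 := by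
    decide +kernel
  rw [nL, pathGraph_four, ← copyCount_mul_card (by decide) (by decide), h, mul_comm]
  norm_num

theorem two_mul_nL_five :
    2 * nL G 5 = embCount G edgesL5 := by
  have h : (Finset.univ.filter fun σ : Equiv.Perm (Fin 5) =>
      mapEdges σ edgesL5 = edgesL5).card = 2 := by
    decide +kernel
  rw [nL, pathGraph_five, ← copyCount_mul_card (by decide) (by decide), h, mul_comm]
  norm_num

theorem eight_mul_nC4 :
    8 * nC4 G = embCount G edgesC4 := by
  have h : (Finset.univ.filter fun σ : Equiv.Perm (Fin 4) =>
      mapEdges σ edgesC4 = edgesC4).card = 8 := by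
    decide +kernel
  rw [nC4, cycleGraph_four, ← copyCount_mul_card (by decide) (by decide), h, mul_comm]
  norm_num

theorem two_mul_nPaw :
    2 * nPaw G = embCount G edgesPaw := by
  have h : (Finset.univ.filter fun σ : Equiv.Perm (Fin 4) =>
      mapEdges σ edgesPaw = edgesPaw).card = 2 := by
    decide +kernel
  rw [nPaw, pawGraph_eq, ← copyCount_mul_card (by decide) (by decide), h, mul_comm]
  norm_num

theorem twelve_mul_nC3L2 :
    12 * nC3L2 G = embCount G edgesC3L2 := by
  have h : (Finset.univ.filter fun σ : Equiv.Perm (Fin 5) =>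
      mapEdges σ edgesC3L2 = edgesC3L2).card = 12 := by
    decide +kernel
  rw [nC3L2, copyCount_congr G triangleEdgeIso, ← copyCount_mul_card (by decide) (by decide),
    h, mul_comm]
  norm_num

end CopyCount

/-! ### Sums over `Q` as sums over embeddings -/

section SumQ

variable {V : Type*} [Fintype V] [DecidableEq V] (G : SimpleGraph V) [DecidableRel G.Adj]

theorem sum_eq_sum_embedding (g : V → ℝ) : ∑ v, g v = ∑ f : Fin 1 ↪ V, g (f 0) := by
  have := sum_embedding_sum (n := 0) fun _ w => g w
  simpa using this

theorem sumQ_eq (F : V → V → V → V → ℝ) : sumQ G F = (1 / 8) *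
    ∑ f : Fin 4 ↪ V, edgeInd G edges2L2 f * F (f 0) (f 1) (f 2) (f 3) := by
  let I : V → V → V → V → ℝ := fun s t u v =>
    if ({s(s, t), s(u, v)} : Finset (Sym2 V)) ∈ indepPairs G then F s t u v else 0
  have h1 : sumQ G F = (1 / 8) * ∑ s, ∑ t, ∑ u, ∑ v, I s t u v := by
    rw [sumQ, ← Finset.mul_sum, Finset.sum_comm]
    congr 1
    refine Finset.sum_congr rfl fun s _ => ?_
    rw [Finset.sum_comm]
    refine Finset.sum_congr rfl fun t _ => ?_
    rw [Finset.sum_comm]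
    refine Finset.sum_congr rfl fun u _ => ?_
    rw [Finset.sum_comm]
    refine Finset.sum_congr rfl fun v _ => ?_
    simp [I, Finset.sum_ite_eq']
  have hI : ∀ s t u v, I s t u v = if G.Adj s t ∧ G.Adj u v ∧ s ≠ u ∧ s ≠ v ∧ t ≠ u ∧ t ≠ v
      then F s t u v else 0 := fun s t u v => by simp only [I, pair_mem_indepPairs]
  -- The unrestricted sums over `s`, `t`, `u`, `v` are made injective one variable at a time: a term
  -- in which the new vertex repeats an old one vanishes, since the endpoints of independent edges
  -- are distinct.
  have h2 : ∑ s, ∑ t, ∑ u, ∑ v, I s t u v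
      = ∑ f : Fin 2 ↪ V, ∑ u, ∑ v, I (f 0) (f 1) u v := by
    rw [sum_eq_sum_embedding, sum_embedding_sum fun f t => ∑ u, ∑ v, I (f 0) t u v,
      Finset.sum_eq_zero, zero_add]
    · rfl
    · intro f _
      simp [hI]
  have h3 : ∑ f : Fin 2 ↪ V, ∑ u, ∑ v, I (f 0) (f 1) u v
      = ∑ f : Fin 3 ↪ V, ∑ v, I (f 0) (f 1) (f 2) v := by
    rw [sum_embedding_sum fun f u => ∑ v, I (f 0) (f 1) u v, Finset.sum_eq_zero, zero_add]
    · rfl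
    · intro f _
      simp [Fin.sum_univ_succ, hI]
  have h4 : ∑ f : Fin 3 ↪ V, ∑ v, I (f 0) (f 1) (f 2) v
      = ∑ f : Fin 4 ↪ V, I (f 0) (f 1) (f 2) (f 3) := by
    rw [sum_embedding_sum fun f v => I (f 0) (f 1) (f 2) v, Finset.sum_eq_zero, zero_add]
    · rfl
    · intro f _
      simp [Fin.sum_univ_succ, hI]
  rw [h1, h2, h3, h4]
  congr 1
  refine Finset.sum_congr rfl fun f _ => ?_
  have h (i j : Fin 4) (hij : i ≠ j) : f i ≠ f j := fun e => hij (f.injective e)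
  rw [edges2L2, ← insert_empty_eq s((2 : Fin 4), 3), edgeInd_insert, edgeInd_insert,
    edgeInd_empty, a_eq, a_eq]
  rw [hI]
  simp only [ne_eq, h _ _ (by decide : (0 : Fin 4) ≠ 2), h _ _ (by decide : (0 : Fin 4) ≠ 3),
    h _ _ (by decide : (1 : Fin 4) ≠ 2), h _ _ (by decide : (1 : Fin 4) ≠ 3), not_false_eq_true,
    and_true]
  by_cases h5 : G.Adj (f 0) (f 1) <;> by_cases h6 : G.Adj (f 2) (f 3) <;> simp [h5, h6]

end SumQ

/-! ### Expansion of the degree weights -/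

section Identities

variable {V : Type*} [Fintype V] [DecidableEq V] (G : SimpleGraph V) [DecidableRel G.Adj]

/-- This and the following expansions go through the possible other ends of the edge added at the
weighted vertex; the vectors `![…]` relabel each resulting pattern to its standard form. -/
theorem embDeg_single : embDeg G edgesL2 0
    = embCount G edgesL2
      + embCount G edgesL3 := by
  rw [embDeg_eq, Fin.sum_univ_two,
    embCount_of_isDiag (E := insert s(0, 0) _) 0 (by decide),
    embCount_reindex (E := insert s(0, 1) _) (E' := edgesL2) ![0, 1]
      (by decide) (by decide),
    embCount_reindex (E := insert s(_, Fin.last 2) _) (E' := edgesL3) ![1, 0, 2]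
      (by decide) (by decide)]
  ring

theorem embDeg_single_new : embDeg G ({s(0, 1)} : Finset (Sym2 (Fin 3))) 2
    = 2 * embCount G edgesL3
      + embCount G edges2L2 := by
  rw [embDeg_eq, Fin.sum_univ_three,
    embCount_reindex (E := insert s(2, 0) _) (E' := edgesL3) ![1, 0, 2]
      (by decide) (by decide),
    embCount_reindex (E := insert s(2, 1) _) (E' := edgesL3) ![0, 1, 2]
      (by decide) (by decide),
    embCount_of_isDiag (E := insert s(2, 2) _) 2 (by decide),
    embCount_reindex (E := insert s(_, Fin.last 3) _) (E' := edges2L2) ![0, 1, 2, 3]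
      (by decide) (by decide)]
  ring

theorem embDeg_pair : embDeg G edges2L2 0
    = embCount G edges2L2
      + 2 * embCount G edgesL4
      + embCount G edgesL2L3 := by
  rw [embDeg_eq, Fin.sum_univ_four,
    embCount_of_isDiag (E := insert s(0, 0) _) 0 (by decide),
    embCount_reindex (E := insert s(0, 1) _) (E' := edges2L2) ![0, 1, 2, 3]
      (by decide) (by decide),
    embCount_reindex (E := insert s(0, 2) _) (E' := edgesL4) ![1, 0, 2, 3]
      (by decide) (by decide),
    embCount_reindex (E := insert s(0, 3) _) (E' := edgesL4) ![1, 0, 3, 2]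
      (by decide) (by decide),
    embCount_reindex (E := insert s(_, Fin.last 4) _) (E' := edgesL2L3) ![2, 3, 0, 1, 4]
      (by decide) (by decide)]
  ring

theorem embDeg_pair_new : embDeg G ({s(0, 1), s(2, 3)} : Finset (Sym2 (Fin 5))) 4
    = 4 * embCount G edgesL2L3
      + embCount G edges3L2 := by
  rw [embDeg_eq, Fin.sum_univ_five,
    embCount_reindex (E := insert s(4, 0) _) (E' := edgesL2L3) ![2, 3, 0, 1, 4]
      (by decide) (by decide),
    embCount_reindex (E := insert s(4, 1) _) (E' := edgesL2L3) ![3, 2, 0, 1, 4]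
      (by decide) (by decide),
    embCount_reindex (E := insert s(4, 2) _) (E' := edgesL2L3) ![0, 1, 2, 3, 4]
      (by decide) (by decide),
    embCount_reindex (E := insert s(4, 3) _) (E' := edgesL2L3) ![0, 1, 3, 2, 4]
      (by decide) (by decide),
    embCount_of_isDiag (E := insert s(4, 4) _) 4 (by decide),
    embCount_reindex (E := insert s(_, Fin.last 5) _) (E' := edges3L2) ![0, 1, 2, 3, 4, 5]
      (by decide) (by decide)]
  ring

theorem embDeg_path_end : embDeg G edgesL4 0
    = embCount G edgesL4
      + embCount G edgesPaw
      + embCount G edgesC4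
      + embCount G edgesL5 := by
  rw [embDeg_eq, Fin.sum_univ_four,
    embCount_of_isDiag (E := insert s(0, 0) _) 0 (by decide),
    embCount_reindex (E := insert s(0, 1) _) (E' := edgesL4) ![0, 1, 2, 3]
      (by decide) (by decide),
    embCount_reindex (E := insert s(0, 2) _) (E' := edgesPaw) ![0, 1, 2, 3]
      (by decide) (by decide),
    embCount_reindex (E := insert s(0, 3) _) (E' := edgesC4) ![0, 1, 2, 3]
      (by decide) (by decide),
    embCount_reindex (E := insert s(_, Fin.last 4) _) (E' := edgesL5) ![1, 2, 3, 4, 0]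
      (by decide) (by decide)]
  ring

theorem embDeg_path_inner : embDeg G edgesL4 1
    = 2 * embCount G edgesL4
      + embCount G edgesPaw
      + embCount G edgesFork := by
  rw [embDeg_eq, Fin.sum_univ_four,
    embCount_reindex (E := insert s(1, 0) _) (E' := edgesL4) ![0, 1, 2, 3]
      (by decide) (by decide),
    embCount_of_isDiag (E := insert s(1, 1) _) 1 (by decide),
    embCount_reindex (E := insert s(1, 2) _) (E' := edgesL4) ![0, 1, 2, 3]
      (by decide) (by decide),
    embCount_reindex (E := insert s(1, 3) _) (E' := edgesPaw) ![3, 2, 0, 1]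
      (by decide) (by decide),
    embCount_reindex (E := insert s(_, Fin.last 4) _) (E' := edgesFork) ![0, 1, 2, 3, 4]
      (by decide) (by decide)]
  ring

theorem embDeg_path_new : embDeg G ({s(0, 1), s(1, 2), s(2, 3)} : Finset (Sym2 (Fin 5))) 4
    = 2 * embCount G edgesL5
      + 2 * embCount G edgesFork
      + embCount G edgesL4L2 := by
  rw [embDeg_eq, Fin.sum_univ_five,
    embCount_reindex (E := insert s(4, 0) _) (E' := edgesL5) ![1, 2, 3, 4, 0]
      (by decide) (by decide),
    embCount_reindex (E := insert s(4, 1) _) (E' := edgesFork) ![0, 1, 2, 3, 4]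
      (by decide) (by decide),
    embCount_reindex (E := insert s(4, 2) _) (E' := edgesFork) ![3, 2, 1, 0, 4]
      (by decide) (by decide),
    embCount_reindex (E := insert s(4, 3) _) (E' := edgesL5) ![0, 1, 2, 3, 4]
      (by decide) (by decide),
    embCount_of_isDiag (E := insert s(4, 4) _) 4 (by decide),
    embCount_reindex (E := insert s(_, Fin.last 5) _) (E' := edgesL4L2) ![1, 0, 2, 3, 4, 5]
      (by decide) (by decide)]
  ring

/-- The pattern comes from expanding the degree at `0` in two disjoint edges by a new vertex `4`.
The remaining weight is at the other end of the same edge, or at an end of the other edge in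
`embDeg_cherry_pair`. -/
theorem embDeg_cherry_leaf : embDeg G ({s(0, 4), s(0, 1), s(2, 3)} : Finset (Sym2 (Fin 5))) 1
    = embCount G edgesL2L3
      + 2 * embCount G edgesL5
      + embCount G edgesC3L2
      + embCount G edgesL4L2 := by
  rw [embDeg_eq, Fin.sum_univ_five,
    embCount_reindex (E := insert s(1, 0) _) (E' := edgesL2L3) ![2, 3, 0, 1, 4]
      (by decide) (by decide),
    embCount_of_isDiag (E := insert s(1, 1) _) 1 (by decide),
    embCount_reindex (E := insert s(1, 2) _) (E' := edgesL5) ![1, 2, 3, 4, 0]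
      (by decide) (by decide),
    embCount_reindex (E := insert s(1, 3) _) (E' := edgesL5) ![1, 2, 4, 3, 0]
      (by decide) (by decide),
    embCount_reindex (E := insert s(1, 4) _) (E' := edgesC3L2) ![0, 1, 3, 4, 2]
      (by decide) (by decide),
    embCount_reindex (E := insert s(_, Fin.last 5) _) (E' := edgesL4L2) ![0, 2, 4, 5, 1, 3]
      (by decide) (by decide)]
  ring

theorem embDeg_cherry_pair : embDeg G ({s(0, 4), s(0, 1), s(2, 3)} : Finset (Sym2 (Fin 5))) 2
    = embCount G edgesFork
      + 2 * embCount G edgesL5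
      + embCount G edgesL2L3
      + embCount G edges2L3 := by
  rw [embDeg_eq, Fin.sum_univ_five,
    embCount_reindex (E := insert s(2, 0) _) (E' := edgesFork) ![1, 0, 2, 3, 4]
      (by decide) (by decide),
    embCount_reindex (E := insert s(2, 1) _) (E' := edgesL5) ![1, 2, 3, 4, 0]
      (by decide) (by decide),
    embCount_of_isDiag (E := insert s(2, 2) _) 2 (by decide),
    embCount_reindex (E := insert s(2, 3) _) (E' := edgesL2L3) ![2, 3, 0, 1, 4]
      (by decide) (by decide),
    embCount_reindex (E := insert s(2, 4) _) (E' := edgesL5) ![1, 0, 3, 4, 2]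
      (by decide) (by decide),
    embCount_reindex (E := insert s(_, Fin.last 5) _) (E' := edges2L3) ![0, 1, 2, 3, 4, 5]
      (by decide) (by decide)]
  ring

theorem embDegDeg_same : embDegDeg G edges2L2 0 1
    = embDeg G edges2L2 0 + 2 * embDeg G edgesL4 0 + embCount G edgesL2L3 + 2 * embCount G edgesL5
      + embCount G edgesC3L2 + embCount G edgesL4L2 := by
  rw [embDegDeg_eq, Fin.sum_univ_four,
    embDeg_of_isDiag (E := insert s(0, 0) _) 0 _ (by decide),
    embDeg_reindex (E := insert s(0, 1) _) (E' := edges2L2) (i := 1) (i' := 0) ![1, 0, 2, 3]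
      (by decide) (by decide) (by decide),
    embDeg_reindex (E := insert s(0, 2) _) (E' := edgesL4) (i := 1) (i' := 0) ![1, 0, 2, 3]
      (by decide) (by decide) (by decide),
    embDeg_reindex (E := insert s(0, 3) _) (E' := edgesL4) (i := 1) (i' := 0) ![1, 0, 3, 2]
      (by decide) (by decide) (by decide),
    embDeg_reindex (E := insert s(_, Fin.last 4) _) (E' := {s(0, 4), s(0, 1), s(2, 3)})
      (i := Fin.castSucc 1) (i' := 1) ![0, 1, 2, 3, 4] (by decide) (by decide) (by decide),
    embDeg_cherry_leaf]
  ring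

theorem embDegDeg_distinct : embDegDeg G edges2L2 0 2
    = embDeg G edges2L2 0 + embDeg G edgesL4 0 + embDeg G edgesL4 1 + embCount G edgesL2L3
      + 2 * embCount G edgesL5 + embCount G edgesFork + embCount G edges2L3 := by
  rw [embDegDeg_eq, Fin.sum_univ_four,
    embDeg_of_isDiag (E := insert s(0, 0) _) 0 _ (by decide),
    embDeg_reindex (E := insert s(0, 1) _) (E' := edges2L2) (i := 2) (i' := 0) ![2, 3, 0, 1]
      (by decide) (by decide) (by decide),
    embDeg_reindex (E := insert s(0, 2) _) (E' := edgesL4) (i := 2) (i' := 1) ![2, 3, 1, 0]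
      (by decide) (by decide) (by decide),
    embDeg_reindex (E := insert s(0, 3) _) (E' := edgesL4) (i := 2) (i' := 0) ![2, 3, 0, 1]
      (by decide) (by decide) (by decide),
    embDeg_reindex (E := insert s(_, Fin.last 4) _) (E' := {s(0, 4), s(0, 1), s(2, 3)})
      (i := Fin.castSucc 2) (i' := 2) ![0, 1, 2, 3, 4] (by decide) (by decide) (by decide),
    embDeg_cherry_pair]
  ring

theorem sum_embDeg_pair : ∑ j, embDeg G edges2L2 j = 4 * embDeg G edges2L2 0 := by
  rw [Fin.sum_univ_four,
    embDeg_reindex (i := 1) (i' := 0) (E' := edges2L2) ![1, 0, 2, 3] (by decide) (by decide) rfl,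
    embDeg_reindex (i := 2) (i' := 0) (E' := edges2L2) ![2, 3, 0, 1] (by decide) (by decide) rfl,
    embDeg_reindex (i := 3) (i' := 0) (E' := edges2L2) ![3, 2, 1, 0] (by decide) (by decide) rfl]
  ring

theorem sum_embDeg_path :
    ∑ j, embDeg G edgesL4 j = 2 * embDeg G edgesL4 0 + 2 * embDeg G edgesL4 1 := by
  rw [Fin.sum_univ_four,
    embDeg_reindex (i := 2) (i' := 1) (E' := edgesL4) ![3, 2, 1, 0] (by decide) (by decide) rfl,
    embDeg_reindex (i := 3) (i' := 0) (E' := edgesL4) ![3, 2, 1, 0] (by decide) (by decide) rfl]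
  ring

/-! ### Frequencies and degree sums in terms of embedding counts -/

theorem freq_t24 : freq G t24 = q G := by
  have h : (indepPairs G ×ˢ indepPairs G).filter (fun x => typeOf x.1 x.2 = t24)
      = (indepPairs G).diag := by
    ext ⟨p, r⟩
    simp only [Finset.mem_filter, Finset.mem_product, Finset.mem_diag]
    constructor
    · rintro ⟨⟨hp, hr⟩, ht⟩
      refine ⟨hp, ?_⟩
      rcases ht ▸ isPattern_typeOf (mem_indepPairs_iff_subset.1 hp).1
        (mem_indepPairs_iff_subset.1 hr).1 with ⟨f, hf, rfl, rfl⟩ | ⟨f, hf, rfl, rfl⟩ <;> rfl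
    · rintro ⟨hp, rfl⟩
      refine ⟨⟨hp, hp⟩, ?_⟩
      have h2 : p.card = 2 := (Finset.mem_powersetCard.1 (Finset.mem_filter.1 hp).1).2
      simp [typeOf, h2]
  rw [freq, h, Finset.diag_card, q]

/-- The pairs of type `24` form the diagonal of `Q × Q`, so the double counting for that type also
counts `Q` itself. -/
theorem eight_mul_q : 8 * q G = embCount G edges2L2 := by
  have h := patSymm_mul_freq G t24
  have e : embCount G (patFst t24 ∪ patSnd t24) = embCount G edges2L2 :=
    embCount_reindex (n := 4) id Function.injective_id (by decide)
  rw [patSymm_t24, freq_t24, e] at h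
  push_cast at h
  linarith

theorem two_mul_K : 2 * K G = embDeg G edges2L2 0 := by
  have h := sum_embDeg_pair G
  simp only [K, sumQ_eq]
  have h2 : ∑ f : Fin 4 ↪ V, edgeInd G edges2L2 f * (k G (f 0) + k G (f 1) + k G (f 2) + k G (f 3))
      = ∑ j, embDeg G edges2L2 j := by
    simp only [embDeg, Fin.sum_univ_four, ← Finset.sum_add_distrib]
    exact Finset.sum_congr rfl fun f _ => by ring
  rw [h2, h]
  ring

theorem four_mul_Phi1 : 4 * Phi1 G = embDegDeg G edges2L2 0 1 := by
  have h : embDegDeg G edges2L2 2 3 = embDegDeg G edges2L2 0 1 :=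
    embDegDeg_reindex ![2, 3, 0, 1] (by decide) (by decide) rfl rfl
  have h2 : ∑ f : Fin 4 ↪ V, edgeInd G edges2L2 f * (k G (f 0) * k G (f 1) + k G (f 2) * k G (f 3))
      = embDegDeg G edges2L2 0 1 + embDegDeg G edges2L2 2 3 := by
    simp only [embDegDeg, ← Finset.sum_add_distrib]
    exact Finset.sum_congr rfl fun f _ => by ring
  simp only [Phi1, sumQ_eq]
  rw [h2, h]
  ring

theorem two_mul_Phi2 : 2 * Phi2 G = embDegDeg G edges2L2 0 2 := by
  have h1 : embDegDeg G edges2L2 0 3 = embDegDeg G edges2L2 0 2 :=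
    embDegDeg_reindex ![0, 1, 3, 2] (by decide) (by decide) rfl rfl
  have h2 : embDegDeg G edges2L2 1 2 = embDegDeg G edges2L2 0 2 :=
    embDegDeg_reindex ![1, 0, 2, 3] (by decide) (by decide) rfl rfl
  have h3 : embDegDeg G edges2L2 1 3 = embDegDeg G edges2L2 0 2 :=
    embDegDeg_reindex ![1, 0, 3, 2] (by decide) (by decide) rfl rfl
  have h4 : ∑ f : Fin 4 ↪ V, edgeInd G edges2L2 f *
      ((k G (f 0) + k G (f 1)) * (k G (f 2) + k G (f 3)))
      = embDegDeg G edges2L2 0 2 + embDegDeg G edges2L2 0 3 + embDegDeg G edges2L2 1 2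
        + embDegDeg G edges2L2 1 3 := by
    simp only [embDegDeg, ← Finset.sum_add_distrib]
    exact Finset.sum_congr rfl fun f _ => by ring
  simp only [Phi2, sumQ_eq]
  rw [h4, h1, h2, h3]
  ring

theorem Lambda1_eq : Lambda1 G = embDeg G edgesL4 0 := by
  have h0 : embDeg G (insert s(1, 2) edges2L2) 0 = embDeg G edgesL4 0 :=
    embDeg_reindex ![0, 1, 2, 3] (by decide) (by decide) rfl
  have h1 : embDeg G (insert s(1, 3) edges2L2) 0 = embDeg G edgesL4 0 :=
    embDeg_reindex ![0, 1, 3, 2] (by decide) (by decide) rfl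
  have h2 : embDeg G (insert s(0, 2) edges2L2) 1 = embDeg G edgesL4 0 :=
    embDeg_reindex ![1, 0, 2, 3] (by decide) (by decide) rfl
  have h3 : embDeg G (insert s(0, 3) edges2L2) 1 = embDeg G edgesL4 0 :=
    embDeg_reindex ![1, 0, 3, 2] (by decide) (by decide) rfl
  have h4 : embDeg G (insert s(0, 3) edges2L2) 2 = embDeg G edgesL4 0 :=
    embDeg_reindex ![2, 3, 0, 1] (by decide) (by decide) rfl
  have h5 : embDeg G (insert s(1, 3) edges2L2) 2 = embDeg G edgesL4 0 :=
    embDeg_reindex ![3, 2, 0, 1] (by decide) (by decide) rfl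
  have h6 : embDeg G (insert s(0, 2) edges2L2) 3 = embDeg G edgesL4 0 :=
    embDeg_reindex ![2, 3, 1, 0] (by decide) (by decide) rfl
  have h7 : embDeg G (insert s(1, 2) edges2L2) 3 = embDeg G edgesL4 0 :=
    embDeg_reindex ![3, 2, 1, 0] (by decide) (by decide) rfl
  have h : ∑ f : Fin 4 ↪ V, edgeInd G edges2L2 f *
      (k G (f 0) * (a G (f 1) (f 2) + a G (f 1) (f 3))
        + k G (f 1) * (a G (f 0) (f 2) + a G (f 0) (f 3))
        + k G (f 2) * (a G (f 0) (f 3) + a G (f 1) (f 3))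
        + k G (f 3) * (a G (f 0) (f 2) + a G (f 1) (f 2)))
      = embDeg G (insert s(1, 2) edges2L2) 0
        + embDeg G (insert s(1, 3) edges2L2) 0
        + embDeg G (insert s(0, 2) edges2L2) 1
        + embDeg G (insert s(0, 3) edges2L2) 1
        + embDeg G (insert s(0, 3) edges2L2) 2
        + embDeg G (insert s(1, 3) edges2L2) 2
        + embDeg G (insert s(0, 2) edges2L2) 3
        + embDeg G (insert s(1, 2) edges2L2) 3 := by
    simp only [embDeg, edgeInd_insert, ← Finset.sum_add_distrib]
    exact Finset.sum_congr rfl fun f _ => by ring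
  rw [Lambda1, sumQ_eq, h, h0, h1, h2, h3, h4, h5, h6, h7]
  ring

theorem Lambda2_eq : Lambda2 G = embDeg G edgesL4 0 + embDeg G edgesL4 1 := by
  have h (i j : Fin 4) : ∑ l, embDeg G (insert s(i, j) edges2L2) l
      = ∑ f : Fin 4 ↪ V, edgeInd G edges2L2 f *
        (a G (f i) (f j) * (k G (f 0) + k G (f 1) + k G (f 2) + k G (f 3))) := by
    simp only [embDeg, edgeInd_insert, Fin.sum_univ_four, ← Finset.sum_add_distrib]
    exact Finset.sum_congr rfl fun f _ => by ring
  have h' {E : Finset (Sym2 (Fin 4))} (g : Fin 4 → Fin 4) (hg : Function.Injective g)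
      (hE : mapEdges g E = edgesL4) : ∑ l, embDeg G E l = ∑ l, embDeg G edgesL4 l :=
    Fintype.sum_bijective g (Finite.injective_iff_bijective.1 hg) _ _ fun l =>
      embDeg_reindex g hg hE rfl
  have h1 : ∑ f : Fin 4 ↪ V, edgeInd G edges2L2 f *
      ((a G (f 0) (f 2) + a G (f 0) (f 3) + a G (f 1) (f 2) + a G (f 1) (f 3)) *
        (k G (f 0) + k G (f 1) + k G (f 2) + k G (f 3))) = 4 * ∑ l, embDeg G edgesL4 l := by
    have e1 := h 0 2
    have e2 := h 0 3
    have e3 := h 1 2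
    have e4 := h 1 3
    rw [h' ![1, 0, 2, 3] (by decide) (by decide)] at e1
    rw [h' ![1, 0, 3, 2] (by decide) (by decide)] at e2
    rw [h' ![0, 1, 2, 3] (by decide) (by decide)] at e3
    rw [h' ![0, 1, 3, 2] (by decide) (by decide)] at e4
    -- Each of the four adjacencies between the two edges completes them to a path on four vertices.
    -- The four equal sums are written out so that each can be replaced by the expression for a
    -- different adjacency.
    rw [show ∀ x : ℝ, 4 * x = x + x + x + x from fun x => by ring]
    nth_rewrite 1 [e1]
    nth_rewrite 1 [e2]
    nth_rewrite 1 [e3]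
    rw [e4]
    simp only [← Finset.sum_add_distrib]
    exact Finset.sum_congr rfl fun f _ => by ring
  rw [Lambda2, sumQ_eq, h1, sum_embDeg_path]
  ring

theorem freq_t13_eq : 2 * freq G t13 = embCount G edgesL2L3 := by
  have h := patSymm_mul_freq G t13
  have e : embCount G (patFst t13 ∪ patSnd t13) = embCount G edgesL2L3 :=
    embCount_reindex (n := 5) ![0, 1, 2, 3, 4] (by decide) (by decide)
  rw [patSymm_t13, e] at h
  push_cast at h
  linarith

theorem freq_t12_eq : 8 * freq G t12 = embCount G edges3L2 := by
  have h := patSymm_mul_freq G t12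
  have e : embCount G (patFst t12 ∪ patSnd t12) = embCount G edges3L2 :=
    embCount_reindex (n := 6) ![0, 1, 2, 3, 4, 5] (by decide) (by decide)
  rw [patSymm_t12, e] at h
  push_cast at h
  linarith

theorem freq_t04_eq : 4 * freq G t04 = embCount G edgesC4 := by
  have h := patSymm_mul_freq G t04
  have e : embCount G (patFst t04 ∪ patSnd t04) = embCount G edgesC4 :=
    embCount_reindex (n := 4) ![0, 1, 3, 2] (by decide) (by decide)
  rw [patSymm_t04, e] at h
  push_cast at h
  linarith

theorem freq_t03_eq : freq G t03 = embCount G edgesL5 := by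
  have h := patSymm_mul_freq G t03
  have e : embCount G (patFst t03 ∪ patSnd t03) = embCount G edgesL5 :=
    embCount_reindex (n := 5) ![1, 0, 2, 3, 4] (by decide) (by decide)
  rw [patSymm_t03, e] at h
  push_cast at h
  linarith

theorem freq_t021_eq : 2 * freq G t021 = embCount G edgesL4L2 := by
  have h := patSymm_mul_freq G t021
  have e : embCount G (patFst t021 ∪ patSnd t021) = embCount G edgesL4L2 :=
    embCount_reindex (n := 6) ![0, 1, 2, 3, 4, 5] (by decide) (by decide)
  rw [patSymm_t021, e] at h
  push_cast at h
  linarith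

theorem freq_t022_eq : 2 * freq G t022 = embCount G edges2L3 := by
  have h := patSymm_mul_freq G t022
  have e : embCount G (patFst t022 ∪ patSnd t022) = embCount G edges2L3 :=
    embCount_reindex (n := 6) ![0, 1, 2, 3, 4, 5] (by decide) (by decide)
  rw [patSymm_t022, e] at h
  push_cast at h
  linarith

theorem two_mul_m_eq : 2 * m G = embCount G edgesL2 := by
  -- The sum of the degrees is the weighted count for the pattern with one vertex and no edge.
  have h : 2 * m G = embDeg G (∅ : Finset (Sym2 (Fin 1))) 0 := by
    rw [two_mul_m, sum_eq_sum_embedding]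
    simp [embDeg, edgeInd_empty]
  rw [h, embDeg_eq, Fin.sum_univ_one, embCount_of_isDiag (E := insert s(0, 0) _) 0 (by decide),
    zero_add]
  exact embCount_reindex (n := 2) id Function.injective_id (by decide)

theorem four_mul_m_sq : 4 * m G ^ 2
    = 2 * embCount G edgesL2 + 4 * embCount G edgesL3 + embCount G edges2L2 := by
  have h := two_mul_m_mul_embCount (G := G) edgesL2
  rw [Fin.sum_univ_two,
    embDeg_reindex (i := 1) (i' := 0) (E' := edgesL2) ![1, 0] (by decide) (by decide) rfl,
    embDeg_reindex (E := mapEdges Fin.castSucc _) (i' := 2) (E' := {s(0, 1)}) ![0, 1, 2]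
      (by decide) (by decide) rfl,
    embDeg_single, embDeg_single_new, ← two_mul_m_eq] at h
  rw [← two_mul_m_eq]
  linarith

theorem two_mul_m_mul_pair : 2 * m G * embCount G edges2L2 = 4 * embDeg G edges2L2 0
    + 4 * embCount G edgesL2L3 + embCount G edges3L2 := by
  rw [two_mul_m_mul_embCount, sum_embDeg_pair,
    embDeg_reindex (E := mapEdges Fin.castSucc _) (i' := 4) (E' := {s(0, 1), s(2, 3)})
      ![0, 1, 2, 3, 4] (by decide) (by decide) rfl, embDeg_pair_new]
  ring

theorem two_mul_m_mul_path : 2 * m G * embCount G edgesL4 = 2 * embDeg G edgesL4 0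
    + 2 * embDeg G edgesL4 1 + 2 * embCount G edgesL5 + 2 * embCount G edgesFork
    + embCount G edgesL4L2 := by
  rw [two_mul_m_mul_embCount, sum_embDeg_path,
    embDeg_reindex (E := mapEdges Fin.castSucc _) (i' := 4) (E' := {s(0, 1), s(1, 2), s(2, 3)})
      ![0, 1, 2, 3, 4] (by decide) (by decide) rfl, embDeg_path_new]
  ring

/-- Closed walks `s t u v` are sorted by their coincidences: `u = s` gives an edge weighted by the
degree of `s`; `u ≠ s` and `v = t` gives a path on three vertices; four distinct vertices give a
cycle. -/
theorem trace_adjMatrix_pow_four : (G.adjMatrix ℝ ^ 4).trace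
    = embCount G edgesL2 + 2 * embCount G edgesL3 + embCount G edgesC4 := by
  have haa (u v : V) : a G u v * a G u v = a G u v := by rw [a_eq]; split_ifs <;> simp
  have hsymm (u v : V) : a G u v = a G v u := by simp only [a_eq, G.adj_comm]
  have hself (u : V) : a G u u = 0 := by simp [a_eq]
  have h1 : (G.adjMatrix ℝ ^ 4).trace
      = ∑ s, ∑ t, ∑ u, ∑ v, a G s t * (a G t u * (a G u v * a G v s)) := by
    have h : G.adjMatrix ℝ ^ 4
        = G.adjMatrix ℝ * (G.adjMatrix ℝ * (G.adjMatrix ℝ * G.adjMatrix ℝ)) := by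
      simp only [pow_succ, pow_zero, one_mul, mul_assoc]
    rw [h]
    simp only [Matrix.trace, Matrix.diag, Matrix.mul_apply, Finset.mul_sum]
    rfl
  have h2 : ∑ s, ∑ t, ∑ u, ∑ v, a G s t * (a G t u * (a G u v * a G v s))
      = ∑ f : Fin 2 ↪ V, ∑ u, ∑ v,
        a G (f 0) (f 1) * (a G (f 1) u * (a G u v * a G v (f 0))) := by
    rw [sum_eq_sum_embedding,
      sum_embedding_sum fun f t => ∑ u, ∑ v, a G (f 0) t * (a G t u * (a G u v * a G v (f 0))),
      Finset.sum_eq_zero, zero_add]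
    · rfl
    · intro f _
      simp [hself]
  have h3 : ∑ f : Fin 2 ↪ V, ∑ u, ∑ v, a G (f 0) (f 1) * (a G (f 1) u * (a G u v * a G v (f 0)))
      = embDeg G edgesL2 0 + ∑ f : Fin 3 ↪ V, ∑ v,
        a G (f 0) (f 1) * (a G (f 1) (f 2) * (a G (f 2) v * a G v (f 0))) := by
    rw [sum_embedding_sum fun f u => ∑ v, a G (f 0) (f 1) * (a G (f 1) u * (a G u v * a G v (f 0)))]
    congr 1
    refine Finset.sum_congr rfl fun f _ => ?_
    rw [Fin.sum_univ_two, edgesL2,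
      ← insert_empty_eq s((0 : Fin 2), 1), edgeInd_insert, edgeInd_empty]
    simp only [hself, zero_mul, mul_zero, Finset.sum_const_zero, add_zero, mul_one]
    simp only [hsymm _ (f 0), haa, ← Finset.mul_sum, k_eq_sum, mul_comm (∑ _, _)]
    rw [← mul_assoc, haa]
  have h4 : ∑ f : Fin 3 ↪ V, ∑ v, a G (f 0) (f 1) * (a G (f 1) (f 2) * (a G (f 2) v * a G v (f 0)))
      = embCount G edgesL3 + embCount G edgesC4 := by
    rw [sum_embedding_sum fun f v =>
      a G (f 0) (f 1) * (a G (f 1) (f 2) * (a G (f 2) v * a G v (f 0)))]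
    congr 1
    · refine Finset.sum_congr rfl fun f _ => ?_
      rw [Fin.sum_univ_three, edgesL3, ← insert_empty_eq s((1 : Fin 3), 2), edgeInd_insert,
        edgeInd_insert, edgeInd_empty]
      simp only [hself, hsymm (f 2) (f 1), hsymm (f 1) (f 0)]
      linear_combination (a G (f 0) (f 1) * a G (f 0) (f 1)) * haa (f 1) (f 2) +
        a G (f 1) (f 2) * haa (f 0) (f 1)
    · refine Finset.sum_congr rfl fun f _ => ?_
      rw [edgesC4, ← insert_empty_eq s((3 : Fin 4), 0), edgeInd_insert, edgeInd_insert,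
        edgeInd_insert, edgeInd_insert, edgeInd_empty, mul_one]
      rfl
  rw [h1, h2, h3, h4, embDeg_single]
  ring

/-! ### Linear elimination: the formulas for the frequencies -/

theorem freq_t13_eq_formula : freq G t13 = K G - 4 * q G - 2 * nL G 4 := by
  have h1 := freq_t13_eq G
  have h2 := two_mul_K G
  rw [embDeg_pair, ← eight_mul_q, ← two_mul_nL_four] at h2
  linarith

theorem freq_t12_eq_formula : freq G t12 = 2 * ((m G + 2) * q G + nL G 4 - K G) := by
  have h1 := freq_t12_eq G
  have h2 := two_mul_m_mul_pair G
  rw [← two_mul_K, ← freq_t13_eq, ← eight_mul_q, freq_t13_eq_formula] at h2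
  linarith

theorem freq_t04_eq_nC4 : freq G t04 = 2 * nC4 G := by
  have h1 := freq_t04_eq G
  have h2 := eight_mul_nC4 G
  linarith

theorem freq_t04_eq_trace : freq G t04
    = (1 / 4) * (G.adjMatrix ℝ ^ 4).trace - nL G 3 - (1 / 2) * nL G 2 := by
  rw [trace_adjMatrix_pow_four, ← freq_t04_eq, ← two_mul_nL_three, ← two_mul_nL_two]
  ring

theorem freq_t04_eq_trace_sq : freq G t04
    = (1 / 4) * (G.adjMatrix ℝ ^ 4).trace + q G - (1 / 2) * m G ^ 2 := by
  have h := four_mul_m_sq G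
  rw [trace_adjMatrix_pow_four, ← freq_t04_eq]
  rw [← eight_mul_q] at h
  linarith

theorem freq_t03_eq_formula :
    freq G t03 = Lambda1 G - 2 * nL G 4 - 8 * nC4 G - 2 * nPaw G := by
  rw [freq_t03_eq, Lambda1_eq, embDeg_path_end, eight_mul_nC4, two_mul_nL_four, two_mul_nPaw]
  ring

/-- The count for `edgesL4L2` occurs in two identities, the expansion of `m` times the count of
four-vertex paths and that of `Phi1`. Either would determine it; the stated form is the mean of
both. The count for `edgesFork` is eliminated through `embDeg_path_inner`. -/
theorem freq_t021_eq_formula : freq G t021 = 2 * q G + (m G + 5) * nL G 4 + 8 * nC4 G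
    + 3 * nPaw G + Phi1 G - 3 * nC3L2 G - Lambda1 G - Lambda2 G - K G := by
  have h1 := freq_t021_eq G
  have h2 := two_mul_m_mul_path G
  have h3 := four_mul_Phi1 G
  have h4 := Lambda1_eq G
  have h5 := Lambda2_eq G
  have h6 := two_mul_K G
  have h7 := embDeg_pair G
  have h8 := embDeg_path_inner G
  have h9 := embDeg_path_end G
  rw [embDegDeg_same] at h3
  have n1 := twelve_mul_nC3L2 G
  have n2 := two_mul_nL_four G
  have n3 := eight_mul_nC4 G
  have n4 := two_mul_nPaw G
  have n5 := eight_mul_q G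
  rw [← n2] at h2
  linarith

/-- The expansion of `Phi2` contains the count for `edgesL5` twice and that for `edgesFork` once.
One copy of the former stays as `nL G 5`; the other, together with the latter, is absorbed into
`Lambda2` through `embDeg_path_end` and `embDeg_path_inner`. -/
theorem freq_t022_eq_formula : freq G t022 = 4 * q G + 5 * nL G 4 + 2 * nPaw G + 4 * nC4 G
    + Phi2 G - Lambda2 G - 2 * K G - nL G 5 := by
  have h1 := freq_t022_eq G
  have h3 := two_mul_Phi2 G
  have h4 := Lambda1_eq G
  have h5 := Lambda2_eq G
  have h6 := two_mul_K G
  have h7 := embDeg_pair G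
  have h8 := embDeg_path_inner G
  have h9 := embDeg_path_end G
  rw [embDegDeg_distinct] at h3
  have n1 := two_mul_nL_five G
  have n2 := two_mul_nL_four G
  have n3 := eight_mul_nC4 G
  have n4 := two_mul_nPaw G
  have n5 := eight_mul_q G
  linarith

/-! ### Forests -/

theorem not_isAcyclic_of_triangle {W : Type*} {H : SimpleGraph W} {x y z : W} (h1 : H.Adj x y)
    (h2 : H.Adj y z) (h3 : H.Adj z x) : ¬ H.IsAcyclic := fun h =>
  h (.cons h1 (.cons h2 (.cons h3 .nil)))
    (by simp [SimpleGraph.Walk.isCycle_def, SimpleGraph.Walk.isTrail_def, h1.ne, h2.ne, h3.ne,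
      h1.ne', h3.ne'])

theorem copyCount_eq_zero_of_isAcyclic {W : Type*} {H : SimpleGraph W} (hG : G.IsAcyclic)
    (hH : ¬ H.IsAcyclic) : G.copyCount H = 0 := by
  rw [SimpleGraph.copyCount_eq_zero]
  rintro ⟨f⟩
  exact hH (hG.comap f.toHom f.injective)

theorem nC4_eq_zero_of_isAcyclic (hG : G.IsAcyclic) : nC4 G = 0 := by
  rw [nC4, copyCount_eq_zero_of_isAcyclic G hG, Nat.cast_zero]
  intro h
  have h1 : (SimpleGraph.cycleGraph 4).Adj 0 1 := by decide
  have h2 : (SimpleGraph.cycleGraph 4).Adj 1 2 := by decide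
  have h3 : (SimpleGraph.cycleGraph 4).Adj 2 3 := by decide
  have h4 : (SimpleGraph.cycleGraph 4).Adj 3 0 := by decide
  exact h (.cons h1 (.cons h2 (.cons h3 (.cons h4 .nil))))
    (by simp [SimpleGraph.Walk.isCycle_def, SimpleGraph.Walk.isTrail_def])

theorem nPaw_eq_zero_of_isAcyclic (hG : G.IsAcyclic) : nPaw G = 0 := by
  rw [nPaw, copyCount_eq_zero_of_isAcyclic G hG, Nat.cast_zero]
  rw [pawGraph_eq]
  exact not_isAcyclic_of_triangle (x := 0) (y := 1) (z := 2) (by decide) (by decide) (by decide)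

theorem nC3L2_eq_zero_of_isAcyclic (hG : G.IsAcyclic) : nC3L2 G = 0 := by
  rw [nC3L2, copyCount_congr G triangleEdgeIso, copyCount_eq_zero_of_isAcyclic G hG, Nat.cast_zero]
  exact not_isAcyclic_of_triangle (x := 0) (y := 1) (z := 2) (by decide) (by decide) (by decide)

end Identities

/-! ### Random layouts: crossing indicators, variance, existence of the constants -/

namespace RandomLayout

variable {V S : Type*} [MeasurableSpace S] (L : RandomLayout V S)

section Basic

variable [DecidableEq V]

theorem α_mapEdges {σ : V → V} (hσ : Function.Injective σ)
    (p : Finset (Sym2 V)) (π : V → S) : L.α (mapEdges σ p) π = L.α p (π ∘ σ) := by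
  have h : (∃ e ∈ mapEdges σ p, ∃ f ∈ mapEdges σ p, e ≠ f ∧ L.cr π e f ≠ 0) ↔
      ∃ e ∈ p, ∃ f ∈ p, e ≠ f ∧ L.cr (π ∘ σ) e f ≠ 0 := by
    simp only [mapEdges, Finset.exists_mem_image, ne_eq, (Sym2.map.injective hσ).eq_iff, cr,
      Sym2.map_map]
  simp only [α, h]

theorem α_pair {e f : Sym2 V} (h : e ≠ f) (π : V → S) :
    L.α {e, f} π = if L.cr π e f ≠ 0 then 1 else 0 := by
  have hc : L.cr π f e = L.cr π e f := L.crossings_comm _ _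
  simp [α, h, h.symm, hc]

theorem measurable_α (p : Finset (Sym2 V)) : Measurable (L.α p) := by
  refine Measurable.ite ?_ measurable_const measurable_const
  have : {π : V → S | ∃ e ∈ p, ∃ f ∈ p, e ≠ f ∧ L.cr π e f ≠ 0}
      = ⋃ e ∈ p, ⋃ f ∈ p, {π | e ≠ f ∧ L.cr π e f ≠ 0} := by
    ext π; simp only [Set.mem_ofPred_eq, Set.mem_iUnion, exists_prop]
  rw [this]
  refine Finset.measurableSet_biUnion _ fun e _ => Finset.measurableSet_biUnion _ fun f _ => ?_
  exact (MeasurableSet.const _).inter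
    (measurableSet_preimage (L.measurable_crossings e f) (MeasurableSet.singleton 0)).compl

theorem α_mul_self (p : Finset (Sym2 V)) (π : V → S) : L.α p π * L.α p π = L.α p π := by
  unfold α; split_ifs <;> simp

theorem norm_α_le (p : Finset (Sym2 V)) (π : V → S) : ‖L.α p π‖ ≤ 1 := by
  unfold α; split_ifs <;> simp

theorem integrable_α (p : Finset (Sym2 V)) : Integrable (L.α p) L.law :=
  have := L.isProbabilityMeasure
  .of_bound (L.measurable_α p).aestronglyMeasurable 1 (.of_forall fun π => L.norm_α_le p π)

theorem integrable_α_sub_mul (p r : Finset (Sym2 V)) (δ : ℝ) :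
    Integrable (fun π => (L.α p π - δ) * (L.α r π - δ)) L.law := by
  have := L.isProbabilityMeasure
  refine .of_bound (((L.measurable_α p).sub_const δ).mul
    ((L.measurable_α r).sub_const δ)).aestronglyMeasurable ((1 + ‖δ‖) * (1 + ‖δ‖))
    (.of_forall fun π => ?_)
  rw [norm_mul]
  gcongr
  · exact (norm_sub_le _ _).trans (by gcongr; exact L.norm_α_le p π)
  · exact (norm_sub_le _ _).trans (by gcongr; exact L.norm_α_le r π)

end Basic

section Variance

variable [Fintype V] [DecidableEq V] (G : SimpleGraph V) [DecidableRel G.Adj] {L}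

/-- The crossing properties remove the terms of an edge with itself and of incident edges, and turn
each remaining crossing number into an indicator. -/
theorem IsGood.C_eq (h : L.IsGood) :
    (fun π => (L.C G π : ℝ)) =ᵐ[L.law] fun π => ∑ p ∈ indepPairs G, L.α p π := by
  filter_upwards [h.no_self, h.once, h.incident] with π h1 h2 h3
  have key : ∀ z ∈ G.edgeFinset.sym2,
      ((Sym2.lift ⟨fun e f => L.cr π e f, fun _ _ => L.crossings_comm _ _⟩ z : ℕ) : ℝ)
        = if z.toFinset ∈ indepPairs G then L.α z.toFinset π else 0 := by
    intro z hz
    induction z with | _ e f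
    rw [Finset.mk_mem_sym2_iff, SimpleGraph.mem_edgeFinset, SimpleGraph.mem_edgeFinset] at hz
    have he := G.not_isDiag_of_mem_edgeSet hz.1
    have hf := G.not_isDiag_of_mem_edgeSet hz.2
    have hset : (s(e, f)).toFinset = {e, f} := by ext; simp
    rw [hset]
    change ((L.cr π e f : ℕ) : ℝ) = _
    by_cases hef : e = f
    · subst hef
      rw [h1 e he, if_neg]
      · simp
      · intro hmem
        have := (Finset.mem_powersetCard.1 (Finset.mem_filter.1 hmem).1).2
        simp at this
    · by_cases hv : ∃ v, v ∈ e ∧ v ∈ f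
      · rw [h3 e f he hf hef hv, if_neg]
        · simp
        · intro hmem
          obtain ⟨v, hve, hvf⟩ := hv
          have := (Finset.mem_filter.1 hmem).2 e (by simp) f (by simp) hef
          exact Finset.disjoint_left.1 this (Sym2.mem_toFinset.2 hve) (Sym2.mem_toFinset.2 hvf)
      · rw [if_pos, L.α_pair hef]
        · have := h2 e f he hf
          interval_cases L.cr π e f <;> simp
        · induction e with | _ s t
          induction f with | _ u v
          exact pair_mem_indepPairs.2 ⟨hz.1, hz.2, fun hh => hv ⟨s, by simp, by simp [hh]⟩,
            fun hh => hv ⟨s, by simp, by simp [hh]⟩, fun hh => hv ⟨t, by simp, by simp [hh]⟩,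
            fun hh => hv ⟨t, by simp, by simp [hh]⟩⟩
  rw [C, Nat.cast_sum, Finset.sum_congr rfl key, ← Finset.sum_filter]
  refine Finset.sum_bij (fun z _ => z.toFinset) ?_ ?_ ?_ ?_
  · intro z hz
    exact (Finset.mem_filter.1 hz).2
  · intro z _ z' _ hzz
    exact Sym2.ext fun x => by rw [← Sym2.mem_toFinset, hzz, Sym2.mem_toFinset]
  · intro p hp
    obtain ⟨s, t, u, v, hc, rfl⟩ := mem_indepPairs.1 hp
    have hset : (s(s(s, t), s(u, v))).toFinset = {s(s, t), s(u, v)} := by ext; simp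
    refine ⟨s(s(s, t), s(u, v)), ?_, hset⟩
    rw [Finset.mem_filter, hset, Finset.mk_mem_sym2_iff]
    exact ⟨by simp [hc.1, hc.2.1], hp⟩
  · intro z _
    rfl

theorem sum_indepPairs_typeOf (E : PairType → ℝ) :
    ∑ p ∈ indepPairs G, ∑ r ∈ indepPairs G, E (typeOf p r) = ∑ ω, freq G ω * E ω := by
  rw [← Finset.sum_product' (f := fun p r => E (typeOf p r)),
    ← Finset.sum_fiberwise (g := fun x : Finset (Sym2 V) × Finset (Sym2 V) => typeOf x.1 x.2)]
  refine Finset.sum_congr rfl fun ω _ => ?_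
  rw [Finset.sum_congr rfl (g := fun _ => E ω), Finset.sum_const, nsmul_eq_mul, freq]
  intro x hx
  rw [(Finset.mem_filter.1 hx).2]

/-- The mean is subtracted term by term, the square of the sum becomes a sum over `Q × Q`, and its
terms are grouped by type. -/
theorem variance_eq_sum_freq (h : L.IsGood) {δ : ℝ} {E : PairType → ℝ} (hc : L.HasConstants δ E) :
    ProbabilityTheory.variance (fun π => (L.C G π : ℝ)) L.law = ∑ ω, freq G ω * E ω := by
  have := L.isProbabilityMeasure
  have hQ : ∀ p ∈ indepPairs G, p ∈ indepPairs (⊤ : SimpleGraph V) := fun p hp =>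
    (mem_indepPairs_iff_subset.1 hp).1
  rw [variance_congr (h.C_eq G), ← sum_indepPairs_typeOf, variance_eq_integral
    (Finset.measurable_sum _ fun p _ => L.measurable_α p).aemeasurable,
    integral_finsetSum _ fun p _ => L.integrable_α p,
    Finset.sum_congr rfl fun p hp => hc.prob_eq p (hQ p hp)]
  simp only [← Finset.sum_sub_distrib, sq, Finset.sum_mul_sum]
  rw [integral_finsetSum _ fun p _ => integrable_finsetSum _ fun r _ =>
    L.integrable_α_sub_mul p r δ]
  refine Finset.sum_congr rfl fun p hp => ?_
  rw [integral_finsetSum _ fun r _ => L.integrable_α_sub_mul p r δ]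
  exact Finset.sum_congr rfl fun r hr => hc.expect_eq p (hQ p hp) r (hQ r hr)

theorem sum_freq_eq (E : PairType → ℝ) : ∑ ω, freq G ω * E ω
    = varianceExpr G E + freq G t00 * E t00 + freq G t01 * E t01 := by
  have h : ∑ ω, freq G ω * E ω = freq G t00 * E t00 + (freq G t24 * E t24 + (freq G t13 * E t13
      + (freq G t12 * E t12 + (freq G t04 * E t04 + (freq G t03 * E t03 + (freq G t021 * E t021
      + (freq G t022 * E t022 + freq G t01 * E t01))))))) := by
    change Finset.sum (insert t00 (insert t24 (insert t13 (insert t12 (insert t04 (insert t03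
      (insert t021 (insert t022 {t01})))))))) _ = _
    simp
  rw [h, freq_t24, freq_t13_eq_formula, freq_t12_eq_formula, freq_t04_eq_nC4, freq_t03_eq_formula,
    freq_t021_eq_formula, freq_t022_eq_formula, varianceExpr]
  ring

theorem varianceExpr_eq_forest (hG : G.IsAcyclic) (E : PairType → ℝ) :
    varianceExpr G E = varianceExprForest G E := by
  rw [varianceExpr, varianceExprForest, nC4_eq_zero_of_isAcyclic G hG,
    nPaw_eq_zero_of_isAcyclic G hG, nC3L2_eq_zero_of_isAcyclic G hG]
  ring

end Variance

section Exchangeable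

variable [Fintype V] [DecidableEq V] {L}

theorem integral_α_mul_eq {E : PairType → ℝ}
    {δ : ℝ} (hc : L.HasConstants δ E) {p r : Finset (Sym2 V)}
    (hp : p ∈ indepPairs (⊤ : SimpleGraph V)) (hr : r ∈ indepPairs (⊤ : SimpleGraph V)) :
    ∫ π, L.α p π * L.α r π ∂L.law = E (typeOf p r) + δ ^ 2 := by
  have := L.isProbabilityMeasure
  have h0 : Integrable (fun π => δ * L.α p π + δ * L.α r π) L.law :=
    ((L.integrable_α p).const_mul δ).add ((L.integrable_α r).const_mul δ)
  have hi : Integrable (fun π => (L.α p π - δ) * (L.α r π - δ) + (δ * L.α p π + δ * L.α r π))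
      L.law := (L.integrable_α_sub_mul p r δ).add h0
  have h1 : ∀ π, L.α p π * L.α r π = (L.α p π - δ) * (L.α r π - δ)
      + (δ * L.α p π + δ * L.α r π) - δ ^ 2 := fun π => by ring
  simp only [h1]
  rw [integral_sub hi (integrable_const _), integral_add (L.integrable_α_sub_mul p r δ) h0,
    integral_add ((L.integrable_α p).const_mul δ) ((L.integrable_α r).const_mul δ),
    integral_const_mul, integral_const_mul, hc.expect_eq p hp r hr, hc.prob_eq p hp,
    hc.prob_eq r hr]
  simp
  ring

theorem measurable_comp_left (σ : V → V) : Measurable fun π : V → S => π ∘ σ :=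
  measurable_pi_lambda _ fun _ => measurable_pi_apply _

theorem IsExchangeable.integral_comp (h : L.IsExchangeable) (σ : Equiv.Perm V) {F : (V → S) → ℝ}
    (hF : Measurable F) : ∫ π, F (π ∘ σ) ∂L.law = ∫ π, F π ∂L.law := by
  conv_rhs => rw [← h σ]
  rw [integral_map (measurable_comp_left σ).aemeasurable hF.aestronglyMeasurable]

/-- Both pairs are images of the same canonical pair up to order, and the symmetric group of `V`
acts transitively on the injections of a given `Fin n` into `V`. -/
theorem exists_perm_of_typeOf_eq {p r p' r' : Finset (Sym2 V)}
    (hp : p ∈ indepPairs (⊤ : SimpleGraph V)) (hr : r ∈ indepPairs (⊤ : SimpleGraph V))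
    (hp' : p' ∈ indepPairs (⊤ : SimpleGraph V)) (hr' : r' ∈ indepPairs (⊤ : SimpleGraph V))
    (h : typeOf p r = typeOf p' r') : ∃ σ : Equiv.Perm V,
      (mapEdges σ p = p' ∧ mapEdges σ r = r') ∨ (mapEdges σ p = r' ∧ mapEdges σ r = p') := by
  have key : ∀ {ω : PairType} {x y x' y' : Finset (Sym2 V)}, IsPattern ω x y → IsPattern ω x' y' →
      ∃ σ : Equiv.Perm V, mapEdges σ x = x' ∧ mapEdges σ y = y' := by
    rintro ω x y x' y' ⟨f, hf, rfl, rfl⟩ ⟨g, hg, rfl, rfl⟩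
    obtain ⟨σ, hσ⟩ : ∃ σ : Equiv.Perm V, ∀ i, σ (f i) = g i := by
      obtain ⟨σ, hσ⟩ := (Equiv.Perm.isMultiplyPretransitive V (patSize ω)).exists_smul_eq
        ⟨f, hf⟩ ⟨g, hg⟩
      exact ⟨σ, fun i => DFunLike.congr_fun hσ i⟩
    have hσ' : σ ∘ f = g := funext hσ
    exact ⟨σ, by rw [mapEdges_mapEdges, hσ'], by rw [mapEdges_mapEdges, hσ']⟩
  rcases isPattern_typeOf hp hr with h1 | h1 <;> rcases h ▸ isPattern_typeOf hp' hr' with h2 | h2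
  · obtain ⟨σ, hσ⟩ := key h1 h2
    exact ⟨σ, .inl hσ⟩
  · obtain ⟨σ, hσ⟩ := key h1 h2
    exact ⟨σ, .inr hσ⟩
  · obtain ⟨σ, hσ⟩ := key h1 h2
    exact ⟨σ, .inr hσ.symm⟩
  · obtain ⟨σ, hσ⟩ := key h1 h2
    exact ⟨σ, .inl hσ.symm⟩

/-- The symmetry of `F` absorbs the possible exchange of the two components. -/
theorem IsExchangeable.integral_eq_of_typeOf_eq (h : L.IsExchangeable)
    {p r p' r' : Finset (Sym2 V)}
    (hp : p ∈ indepPairs (⊤ : SimpleGraph V)) (hr : r ∈ indepPairs (⊤ : SimpleGraph V))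
    (hp' : p' ∈ indepPairs (⊤ : SimpleGraph V)) (hr' : r' ∈ indepPairs (⊤ : SimpleGraph V))
    (ht : typeOf p r = typeOf p' r') {F : ℝ → ℝ → ℝ} (hF : Measurable fun x : ℝ × ℝ => F x.1 x.2)
    (hcomm : ∀ x y, F x y = F y x) :
    ∫ π, F (L.α p π) (L.α r π) ∂L.law = ∫ π, F (L.α p' π) (L.α r' π) ∂L.law := by
  have hm : Measurable fun π => F (L.α p π) (L.α r π) :=
    hF.comp ((L.measurable_α p).prodMk (L.measurable_α r))
  obtain ⟨σ, ⟨rfl, rfl⟩ | ⟨rfl, rfl⟩⟩ := exists_perm_of_typeOf_eq hp hr hp' hr' ht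
  · rw [← h.integral_comp σ hm]
    simp only [L.α_mapEdges σ.injective]
  · rw [← h.integral_comp σ hm]
    simp only [L.α_mapEdges σ.injective]
    exact integral_congr_ae (.of_forall fun π => hcomm _ _)

theorem IsExchangeable.exists_hasConstants (h : L.IsExchangeable) :
    ∃ (δ : ℝ) (E : PairType → ℝ), L.HasConstants δ E := by
  classical
  have hself : ∀ p ∈ indepPairs (⊤ : SimpleGraph V), typeOf p p = t24 := by
    intro p hp
    have h2 : p.card = 2 := (Finset.mem_powersetCard.1 (Finset.mem_filter.1 hp).1).2
    simp [typeOf, h2]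
  -- The constants are read off chosen representatives, with the default value `0` when there are
  -- too few vertices for any to exist.
  let δ : ℝ := if hx : ∃ p, p ∈ indepPairs (⊤ : SimpleGraph V) then
    ∫ π, L.α hx.choose π ∂L.law else 0
  let E : PairType → ℝ := fun ω =>
    if hx : ∃ x : Finset (Sym2 V) × Finset (Sym2 V), x.1 ∈ indepPairs (⊤ : SimpleGraph V) ∧
      x.2 ∈ indepPairs (⊤ : SimpleGraph V) ∧ typeOf x.1 x.2 = ω then
    ∫ π, (L.α hx.choose.1 π - δ) * (L.α hx.choose.2 π - δ) ∂L.law else 0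
  refine ⟨δ, E, ⟨fun p hp => ?_, fun p hp r hr => ?_⟩⟩
  · have hx : ∃ p, p ∈ indepPairs (⊤ : SimpleGraph V) := ⟨p, hp⟩
    have hδ : δ = ∫ π, L.α hx.choose π ∂L.law := dif_pos hx
    rw [hδ]
    -- Single pairs are treated as diagonal pairs of type `24`, since an indicator equals its
    -- square.
    have := h.integral_eq_of_typeOf_eq hp hp hx.choose_spec hx.choose_spec
      ((hself p hp).trans (hself _ hx.choose_spec).symm) (F := fun x y => x * y)
      (measurable_fst.mul measurable_snd) mul_comm
    simpa only [α_mul_self] using this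
  · have hx : ∃ x : Finset (Sym2 V) × Finset (Sym2 V), x.1 ∈ indepPairs (⊤ : SimpleGraph V) ∧
      x.2 ∈ indepPairs (⊤ : SimpleGraph V) ∧ typeOf x.1 x.2 = typeOf p r := ⟨(p, r), hp, hr, rfl⟩
    have hE : E (typeOf p r) = ∫ π, (L.α hx.choose.1 π - δ) * (L.α hx.choose.2 π - δ) ∂L.law :=
      dif_pos hx
    rw [hE]
    obtain ⟨h1, h2, h3⟩ := hx.choose_spec
    exact h.integral_eq_of_typeOf_eq hp hr h1 h2 h3.symm (F := fun x y => (x - δ) * (y - δ))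
      ((measurable_fst.sub_const δ).mul (measurable_snd.sub_const δ)) fun x y => mul_comm _ _

end Exchangeable

section Homogeneous

variable [Fintype V] [DecidableEq V] {L}

theorem IsHomogeneous.isExchangeable (h : L.IsHomogeneous) : L.IsExchangeable := by
  obtain ⟨ν, hν, hlaw, -⟩ := h
  intro σ
  rw [hlaw]
  have := (measurePreserving_piCongrLeft (fun _ : V => ν) σ.symm).map_eq
  convert! this using 2
  ext π v
  have h2 := Equiv.piCongrLeft_apply_apply (fun _ : V => S) σ.symm π (σ v)
  rw [Equiv.symm_apply_apply] at h2
  exact h2.symm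

theorem α_congr {p : Finset (Sym2 V)} {π π' : V → S} (h : ∀ v ∈ vertices p, π v = π' v) :
    L.α p π = L.α p π' := by
  have h1 : ∀ e ∈ p, e.map π = e.map π' := by
    intro e he
    refine Sym2.map_congr fun v hv => h v ?_
    exact Finset.mem_biUnion.2 ⟨e, he, Sym2.mem_toFinset.2 hv⟩
  have h2 : (∃ e ∈ p, ∃ f ∈ p, e ≠ f ∧ L.cr π e f ≠ 0) ↔
      ∃ e ∈ p, ∃ f ∈ p, e ≠ f ∧ L.cr π' e f ≠ 0 := by
    refine exists_congr fun e => and_congr_right fun he => exists_congr fun f =>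
      and_congr_right fun hf => ?_
    rw [cr, cr, h1 e he, h1 f hf]
  simp only [α, h2]

theorem α_comp_left {g : S → S}
    (hg : ∀ a b : Sym2 S, L.crossings (a.map g) (b.map g) = L.crossings a b)
    (p : Finset (Sym2 V)) (π : V → S) : L.α p (g ∘ π) = L.α p π := by
  have h : ∀ e f, L.cr (g ∘ π) e f = L.cr π e f := fun e f => by
    rw [cr, cr, ← Sym2.map_map, ← Sym2.map_map, hg]
  simp only [α, h]

/-- In a homogeneous layout, pairs with at most one common vertex are uncorrelated. -/
theorem IsHomogeneous.integral_eq_zero (h : L.IsHomogeneous) {p r : Finset (Sym2 V)} {x : V}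
    (hx : vertices p ∩ vertices r ⊆ {x}) {δ : ℝ} (hδ : ∫ π, L.α p π ∂L.law = δ) :
    ∫ π, (L.α p π - δ) * (L.α r π - δ) ∂L.law = 0 := by
  have hint := L.integrable_α_sub_mul p r δ
  have hintp := L.integrable_α p
  obtain ⟨ν, hν, hlaw, hg⟩ := h
  rw [hlaw] at hδ hint hintp ⊢
  -- The endpoints of `p` other than `x` are integrated first. The remaining coordinates include `x`
  -- and all the endpoints of `r`.
  let P : V → Prop := fun v => v ∈ vertices p ∧ v ≠ x
  let e := MeasurableEquiv.piEquivPiSubtypeProd (fun _ : V => S) P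
  have he : MeasurePreserving e.symm _ _ :=
    (measurePreserving_piEquivPiSubtypeProd (fun _ : V => ν) P).symm
  have heP (y : ({v // P v} → S) × ({v // ¬ P v} → S)) (v : V) (hv : P v) :
      e.symm y v = y.1 ⟨v, hv⟩ := by
    exact dif_pos hv
  have heN (y : ({v // P v} → S) × ({v // ¬ P v} → S)) (v : V) (hv : ¬ P v) :
      e.symm y v = y.2 ⟨v, hv⟩ := by
    exact dif_neg hv
  have hxP : ¬ P x := fun h => h.2 rfl
  let I : ({v // ¬ P v} → S) → ℝ := fun b => ∫ a, L.α p (e.symm (a, b)) ∂Measure.pi fun _ => ν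
  -- Given the other coordinates, `α p` depends only on the position of `x`. The map `g` that moves
  -- this position preserves the crossings and the law of the integrated coordinates.
  have hI : ∀ b b', I b = I b' := by
    intro b b'
    obtain ⟨g, hgν, hgx, hgc⟩ := hg (b ⟨x, hxP⟩) (b' ⟨x, hxP⟩)
    have h1 : ∀ a, L.α p (e.symm (a, b)) = L.α p (e.symm (g ∘ a, b')) := by
      intro a
      rw [← α_comp_left hgc]
      refine α_congr fun v hv => ?_
      by_cases hvx : v = x
      · subst hvx
        simp only [Function.comp, heN _ _ hxP, hgx]
      · simp only [Function.comp, heP _ v ⟨hv, hvx⟩]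
    have h2 : MeasurePreserving (fun a : {v // P v} → S => g ∘ a)
        (Measure.pi fun _ => ν) (Measure.pi fun _ => ν) :=
      measurePreserving_pi (fun _ => ν) (fun _ => ν) fun _ => hgν
    have h3 : Measurable fun a : {v // P v} → S => L.α p (e.symm (a, b')) :=
      (L.measurable_α p).comp (e.symm.measurable.comp (measurable_id.prodMk measurable_const))
    simp only [I, h1]
    conv_rhs => rw [← h2.map_eq]
    rw [integral_map h2.aemeasurable h3.aestronglyMeasurable]
  have hb : ∀ b, I b = δ := by
    intro b
    rw [← hδ, ← he.integral_comp' (g := L.α p), integral_prod_symm]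
    · have : ∀ b', ∫ a, L.α p (e.symm (a, b')) ∂Measure.pi (fun _ => ν) = I b := fun b' => hI b' b
      simp [this]
    · exact he.integrable_comp_of_integrable hintp
  rw [← he.integral_comp' (g := fun π => (L.α p π - δ) * (L.α r π - δ)), integral_prod_symm]
  · refine integral_eq_zero_of_ae (.of_forall fun b => ?_)
    obtain ⟨a₀⟩ : Nonempty ({v // P v} → S) :=
      (Measure.pi fun _ : {v // P v} => ν).nonempty_of_neZero
    have hr : ∀ a, L.α r (e.symm (a, b)) = L.α r (e.symm (a₀, b)) := by
      intro a
      refine α_congr fun v hv => ?_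
      have hvP : ¬ P v := fun hP => hP.2 (by
        simpa using hx (Finset.mem_inter.2 ⟨hP.1, hv⟩))
      rw [heN _ _ hvP, heN _ _ hvP]
    have hm : Measurable fun a : {v // P v} → S => L.α p (e.symm (a, b)) :=
      (L.measurable_α p).comp (e.symm.measurable.comp (measurable_id.prodMk measurable_const))
    simp only [hr, integral_mul_const]
    rw [integral_sub, show ∫ a, L.α p (e.symm (a, b)) ∂Measure.pi (fun _ => ν) = δ from hb b]
    · simp
    · exact .of_bound hm.aestronglyMeasurable 1 (.of_forall fun a => L.norm_α_le p _)
    · exact integrable_const δ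
  · exact he.integrable_comp_of_integrable hint

theorem IsHomogeneous.exists_hasConstants (h : L.IsHomogeneous) :
    ∃ (δ : ℝ) (E : PairType → ℝ), L.HasConstants δ E ∧ E t00 = 0 ∧ E t01 = 0 := by
  obtain ⟨δ, E, hE⟩ := h.isExchangeable.exists_hasConstants
  -- `E` is unconstrained at types that do not occur, so the two values are reset to `0`; where
  -- these types do occur, the expectation is `0` anyway.
  refine ⟨δ, fun ω => if ω = t00 ∨ ω = t01 then 0 else E ω, ⟨hE.prob_eq, fun p hp r hr => ?_⟩,
    by simp, by simp⟩
  split_ifs with ht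
  · have hc : (vertices p ∩ vertices r).card ≤ 1 := by
      unfold typeOf at ht
      split at ht <;> first | omega | (split_ifs at ht <;> simp at ht) | simp at ht
    obtain ⟨s, t, u, v, -, hp'⟩ := mem_indepPairs.1 hp
    have : Nonempty V := ⟨s⟩
    obtain ⟨x, hx⟩ := Finset.card_le_one_iff_subset_singleton.1 hc
    exact h.integral_eq_zero hx (hE.prob_eq p hp)
  · exact hE.expect_eq p hp r hr

end Homogeneous

end RandomLayout

/-! ### Crossings of arcs above a line -/

section Arcs

theorem arcCrossings_mk {n : ℕ} (x y z w : Fin n) : arcCrossings s(x, y) s(z, w) =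
    if (min x.val y < min z.val w ∧ min z.val w < max x.val y ∧ max x.val y < max z.val w) ∨
      (min z.val w < min x.val y ∧ min x.val y < max z.val w ∧ max z.val w < max x.val y)
    then 1 else 0 := by
  have hmin : ∀ a b : Fin n, ((a ⊓ b : Fin n) : ℕ) = min a.val b := fun a b => by
    rcases le_total a b with h | h <;> simp [h]
  have hmax : ∀ a b : Fin n, ((a ⊔ b : Fin n) : ℕ) = max a.val b := fun a b => by
    rcases le_total a b with h | h <;> simp [h]
  simp only [arcCrossings, Sym2.inf_mk, Sym2.sup_mk, Fin.lt_def, hmin, hmax]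

theorem arcCrossings_self {n : ℕ} (a : Sym2 (Fin n)) : arcCrossings a a = 0 := by
  simp [arcCrossings]

theorem arcCrossings_le_one {n : ℕ} (a b : Sym2 (Fin n)) : arcCrossings a b ≤ 1 := by
  unfold arcCrossings; split_ifs <;> simp

theorem arcCrossings_incident {n : ℕ} (x y z : Fin n) : arcCrossings s(x, y) s(x, z) = 0 := by
  rw [arcCrossings_mk, if_neg]
  omega

/-- Interleaving depends only on the relative order of the endpoints, which reduces questions about
any positions to `Fin l`. -/
theorem arcCrossings_map {n l : ℕ} {g : Fin l → Fin n} (hg : StrictMono g) (a b : Sym2 (Fin l)) :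
    arcCrossings (a.map g) (b.map g) = arcCrossings a b := by
  induction a with | _ x y
  induction b with | _ z w
  have hmin : ∀ a b, g a ⊓ g b = g (a ⊓ b) := fun a b => (hg.monotone.map_min).symm
  have hmax : ∀ a b, g a ⊔ g b = g (a ⊔ b) := fun a b => (hg.monotone.map_max).symm
  simp only [arcCrossings, Sym2.map_mk, Sym2.inf_mk, Sym2.sup_mk, hmin, hmax, hg.lt_iff_lt]
  congr

/-- An injective tuple is a permutation of an increasing one. -/
theorem exists_strictMono_comp_perm {n l : ℕ} {g : Fin l → Fin n} (hg : Function.Injective g) :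
    ∃ (h : Fin l → Fin n) (τ : Equiv.Perm (Fin l)), StrictMono h ∧ g = h ∘ τ :=
  ⟨g ∘ Tuple.sort g, (Tuple.sort g).symm,
    (Tuple.monotone_sort g).strictMono_of_injective (hg.comp (Tuple.sort g).injective), by
    ext i; simp⟩

theorem perm_four_matchings : ∀ τ : Equiv.Perm (Fin 4),
    arcCrossings s(τ 0, τ 1) s(τ 2, τ 3) + arcCrossings s(τ 0, τ 2) s(τ 1, τ 3)
      + arcCrossings s(τ 0, τ 3) s(τ 1, τ 2) = 1 := by
  decide +kernel

/-- Exactly one of the three perfect matchings of four points on a line has a crossing. -/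
theorem arcCrossings_matchings {n : ℕ} {x y z w : Fin n} (h : x ≠ y ∧ z ≠ w ∧ x ≠ z ∧ x ≠ w ∧
    y ≠ z ∧ y ≠ w) : arcCrossings s(x, y) s(z, w) + arcCrossings s(x, z) s(y, w)
      + arcCrossings s(x, w) s(y, z) = 1 := by
  have hinj : Function.Injective ![x, y, z, w] :=
    List.nodup_ofFn.1 (by simp [List.ofFn_succ]; tauto)
  obtain ⟨g, τ, hg, he⟩ := exists_strictMono_comp_perm hinj
  have h0 : x = g (τ 0) := congrFun he 0
  have h1 : y = g (τ 1) := congrFun he 1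
  have h2 : z = g (τ 2) := congrFun he 2
  have h3 : w = g (τ 3) := congrFun he 3
  rw [h0, h1, h2, h3]
  simp only [← Sym2.map_mk, arcCrossings_map hg]
  exact perm_four_matchings τ

/-- Write `g = h ∘ τ` with `h` increasing: crossings ignore `h`, and `τ` is absorbed by the sum over
all permutations. -/
theorem sum_perm_arcCrossings {n l : ℕ} {g : Fin l → Fin n} (hg : Function.Injective g)
    (i j s t i' j' s' t' : Fin l) :
    ∑ σ : Equiv.Perm (Fin l), arcCrossings s(g (σ i), g (σ j)) s(g (σ s), g (σ t)) *
        arcCrossings s(g (σ i'), g (σ j')) s(g (σ s'), g (σ t'))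
      = ∑ σ : Equiv.Perm (Fin l), arcCrossings s(σ i, σ j) s(σ s, σ t) *
        arcCrossings s(σ i', σ j') s(σ s', σ t') := by
  obtain ⟨h, τ, hh, rfl⟩ := exists_strictMono_comp_perm hg
  refine Fintype.sum_equiv (Equiv.mulLeft τ) _ _ fun σ => ?_
  simp only [Function.comp, ← Sym2.map_mk, arcCrossings_map hh]
  rfl

/-- For type `13` the joint crossing probability is `20/120 = 1/6`, and `1/6 - 1/9 = 1/18`. -/
theorem sum_perm_five : ∑ σ : Equiv.Perm (Fin 5), arcCrossings s(σ 0, σ 1) s(σ 2, σ 3) *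
    arcCrossings s(σ 0, σ 1) s(σ 2, σ 4) = 20 := by
  decide +kernel

/-- For type `12` the joint crossing probability is `96/720 = 2/15`, and `2/15 - 1/9 = 1/45`. -/
theorem sum_perm_six : ∑ σ : Equiv.Perm (Fin 6), arcCrossings s(σ 0, σ 1) s(σ 2, σ 3) *
    arcCrossings s(σ 0, σ 1) s(σ 4, σ 5) = 96 := by
  decide +kernel

end Arcs

/-! ### The constants of uniformly random linear arrangements -/

section Linear

variable {V : Type*} [Fintype V]

theorem rla_isGood : (rla V).IsGood where
  no_self := .of_forall fun _ _ _ => arcCrossings_self _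
  once := .of_forall fun _ _ _ _ _ => arcCrossings_le_one _ _
  incident := .of_forall fun π e f _ _ _ h => by
    obtain ⟨v, hve, hvf⟩ := h
    obtain ⟨x, rfl⟩ := Sym2.mem_iff_exists.1 hve
    obtain ⟨y, rfl⟩ := Sym2.mem_iff_exists.1 hvf
    exact arcCrossings_incident _ _ _

theorem rla_isExchangeable : (rla V).IsExchangeable := by
  intro σ
  let T : (V → Fin (Fintype.card V)) ≃ (V → Fin (Fintype.card V)) := σ.arrowCongr (Equiv.refl _)
  have hT : (fun π : V → Fin (Fintype.card V) => π ∘ σ) = T.symm := by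
    ext π v; simp [T]
  have hs : T.symm ⁻¹' linearArrangements V = linearArrangements V := by
    ext π
    simp only [Set.mem_preimage, linearArrangements, ← hT, Set.mem_ofPred_eq]
    exact ⟨fun h => by simpa [Function.comp_assoc] using h.comp σ.symm.bijective,
      fun h => h.comp σ.bijective⟩
  rw [hT]
  refine Measure.ext fun t ht => ?_
  rw [Measure.map_apply Measurable.of_discrete ht]
  simp only [rla, uniformOn]
  rw [cond_apply (MeasurableSet.of_discrete), cond_apply (MeasurableSet.of_discrete)]
  congr 1
  nth_rewrite 1 [← hs]
  rw [← Set.preimage_inter, ← Equiv.image_eq_preimage_symm,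
    Measure.count_injective_image T.injective]

theorem rla_ae_injective : ∀ᵐ π ∂(rla V).law, Function.Injective π := by
  have : ∀ᵐ π ∂(rla V).law, π ∈ linearArrangements V :=
    ae_cond_mem MeasurableSet.of_discrete
  filter_upwards [this] with π hπ using hπ.injective

variable [DecidableEq V]

theorem rla_α_pair {s t u v : V} (h : s ≠ t ∧ u ≠ v ∧ s ≠ u ∧ s ≠ v ∧ t ≠ u ∧ t ≠ v)
    (π : V → Fin (Fintype.card V)) :
    (rla V).α {s(s, t), s(u, v)} π = arcCrossings s(π s, π t) s(π u, π v) := by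
  have hne : s(s, t) ≠ s(u, v) := by simp [h.2.2.1, h.2.2.2.1]
  have h1 : (rla V).cr π s(s, t) s(u, v) = arcCrossings s(π s, π t) s(π u, π v) := rfl
  have h2 := arcCrossings_le_one s(π s, π t) s(π u, π v)
  rw [RandomLayout.α_pair _ hne, h1]
  interval_cases arcCrossings s(π s, π t) s(π u, π v) <;> simp

theorem rla_sum_matchings {s t u v : V} (h : s ≠ t ∧ u ≠ v ∧ s ≠ u ∧ s ≠ v ∧ t ≠ u ∧ t ≠ v)
    {π : V → Fin (Fintype.card V)} (hπ : Function.Injective π) :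
    (rla V).α {s(s, t), s(u, v)} π + (rla V).α {s(s, u), s(t, v)} π
      + (rla V).α {s(s, v), s(t, u)} π = 1 := by
  have h' : π s ≠ π t ∧ π u ≠ π v ∧ π s ≠ π u ∧ π s ≠ π v ∧ π t ≠ π u ∧ π t ≠ π v := by
    simpa [hπ.ne_iff, hπ.eq_iff] using h
  rw [rla_α_pair h, rla_α_pair (by tauto), rla_α_pair (by tauto)]
  exact_mod_cast arcCrossings_matchings h'

/-- The indicators of the three matchings of four vertices have the same mean and add up to `1`. -/
theorem rla_prob_eq {δ : ℝ} {E : PairType → ℝ} (hc : (rla V).HasConstants δ E) {s t u v : V}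
    (h : s ≠ t ∧ u ≠ v ∧ s ≠ u ∧ s ≠ v ∧ t ≠ u ∧ t ≠ v) : δ = 1 / 3 := by
  have := (rla V).isProbabilityMeasure
  have h1 := hc.prob_eq {s(s, t), s(u, v)} (pair_mem_indepPairs_top.2 h)
  have h2 := hc.prob_eq {s(s, u), s(t, v)} (pair_mem_indepPairs_top.2 (by tauto))
  have h3 := hc.prob_eq {s(s, v), s(t, u)} (pair_mem_indepPairs_top.2 (by tauto))
  have h4 : ∫ π, ((rla V).α {s(s, t), s(u, v)} π + (rla V).α {s(s, u), s(t, v)} π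
      + (rla V).α {s(s, v), s(t, u)} π) ∂(rla V).law = 1 := by
    rw [integral_congr_ae (g := fun _ => 1)]
    · simp
    · filter_upwards [rla_ae_injective] with π hπ using rla_sum_matchings h hπ
  rw [integral_add, integral_add, h1, h2, h3] at h4
  · linarith
  · exact (rla V).integrable_α _
  · exact (rla V).integrable_α _
  · exact ((rla V).integrable_α _).add ((rla V).integrable_α _)
  · exact (rla V).integrable_α _

/-- The centred indicators of the three matchings add up to `0` almost surely, and this survives
multiplication by the centred indicator of a fixed pair. Each choice of `R` yields one linear
relation between the constants. -/
theorem rla_sum_constants {E : PairType → ℝ} (hc : (rla V).HasConstants (1 / 3) E) {n : ℕ}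
    {f : Fin n → V} (hf : Function.Injective f) {R : Finset (Sym2 (Fin n))}
    (hR : R ∈ indepPairs (⊤ : SimpleGraph (Fin n))) {s t u v : Fin n}
    (h : s ≠ t ∧ u ≠ v ∧ s ≠ u ∧ s ≠ v ∧ t ≠ u ∧ t ≠ v) :
    E (typeOf {s(s, t), s(u, v)} R) + E (typeOf {s(s, u), s(t, v)} R)
      + E (typeOf {s(s, v), s(t, u)} R) = 0 := by
  have key : ∀ P : Finset (Sym2 (Fin n)), P ∈ indepPairs (⊤ : SimpleGraph (Fin n)) →
      E (typeOf P R) = ∫ π, ((rla V).α (mapEdges f P) π - 1 / 3) *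
        ((rla V).α (mapEdges f R) π - 1 / 3) ∂(rla V).law := fun P hP => by
    rw [← typeOf_mapEdges hf P R]
    exact (hc.expect_eq _ (mapEdges_mem_indepPairs_top hf hP) _
      (mapEdges_mem_indepPairs_top hf hR)).symm
  have h' : f s ≠ f t ∧ f u ≠ f v ∧ f s ≠ f u ∧ f s ≠ f v ∧ f t ≠ f u ∧ f t ≠ f v := by
    simpa [hf.ne_iff, hf.eq_iff] using h
  rw [key _ (pair_mem_indepPairs_top.2 h), key _ (pair_mem_indepPairs_top.2 (by tauto)),
    key _ (pair_mem_indepPairs_top.2 (by tauto)), ← integral_add, ← integral_add]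
  · refine integral_eq_zero_of_ae ?_
    filter_upwards [rla_ae_injective] with π hπ
    have := rla_sum_matchings h' hπ
    simp only [mapEdges_pair, Pi.zero_apply]
    linear_combination ((rla V).α (mapEdges f R) π - 1 / 3) * this
  · exact ((rla V).integrable_α_sub_mul _ _ _).add ((rla V).integrable_α_sub_mul _ _ _)
  · exact (rla V).integrable_α_sub_mul _ _ _
  · exact (rla V).integrable_α_sub_mul _ _ _
  · exact (rla V).integrable_α_sub_mul _ _ _

/-- The joint crossing probability of a pattern is its average over the orders of the vertices. -/
theorem rla_card_mul_constants {E : PairType → ℝ} {δ : ℝ} (hc : (rla V).HasConstants δ E) {n : ℕ}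
    {f : Fin n → V} (hf : Function.Injective f) {s t u v s' t' u' v' : Fin n}
    (h : s ≠ t ∧ u ≠ v ∧ s ≠ u ∧ s ≠ v ∧ t ≠ u ∧ t ≠ v)
    (h' : s' ≠ t' ∧ u' ≠ v' ∧ s' ≠ u' ∧ s' ≠ v' ∧ t' ≠ u' ∧ t' ≠ v') :
    n.factorial * (E (typeOf {s(s, t), s(u, v)} {s(s', t'), s(u', v')}) + δ ^ 2)
      = (∑ σ : Equiv.Perm (Fin n), arcCrossings s(σ s, σ t) s(σ u, σ v) *
        arcCrossings s(σ s', σ t') s(σ u', σ v') : ℕ) := by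
  have := (rla V).isProbabilityMeasure
  have hmem := pair_mem_indepPairs_top.2 h
  have hmem' := pair_mem_indepPairs_top.2 h'
  -- All the relabelled embeddings `f ∘ σ` give the same type, hence the same expectation. Their sum
  -- is integrated instead, because on injective arrangements it is constant.
  have key : ∀ σ : Equiv.Perm (Fin n),
      ∫ π, (rla V).α (mapEdges (f ∘ σ) {s(s, t), s(u, v)}) π *
        (rla V).α (mapEdges (f ∘ σ) {s(s', t'), s(u', v')}) π ∂(rla V).law
      = E (typeOf {s(s, t), s(u, v)} {s(s', t'), s(u', v')}) + δ ^ 2 := by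
    intro σ
    have hfσ := hf.comp σ.injective
    rw [RandomLayout.integral_α_mul_eq hc (mapEdges_mem_indepPairs_top hfσ hmem)
      (mapEdges_mem_indepPairs_top hfσ hmem'), typeOf_mapEdges hfσ]
  have hsum := Finset.sum_congr rfl fun σ (_ : σ ∈ Finset.univ) => key σ
  rw [Finset.sum_const, Finset.card_univ, Fintype.card_perm, Fintype.card_fin, nsmul_eq_mul,
    ← integral_finsetSum] at hsum
  · rw [← hsum, integral_congr_ae (g := fun _ => ((∑ σ : Equiv.Perm (Fin n),
      arcCrossings s(σ s, σ t) s(σ u, σ v) * arcCrossings s(σ s', σ t') s(σ u', σ v') : ℕ) : ℝ))]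
    · simp
    · filter_upwards [rla_ae_injective] with π hπ
      rw [← sum_perm_arcCrossings (hπ.comp hf) s t u v s' t' u' v', Nat.cast_sum]
      refine Finset.sum_congr rfl fun σ _ => ?_
      have hfσ := hf.comp σ.injective
      rw [mapEdges_pair, mapEdges_pair, rla_α_pair, rla_α_pair, Nat.cast_mul]
      · rfl
      · simpa [hfσ.ne_iff, hf.eq_iff] using h'
      · simpa [hfσ.ne_iff, hf.eq_iff] using h
  · intro σ _
    simp

/-- The injection `f` ensures that the type occurs in `V`; otherwise `E ω` would be arbitrary. Types
`24`, `13` and `12` are computed directly, and the others come from the matching relations. -/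
theorem rla_constants_eq {E : PairType → ℝ} (hc : (rla V).HasConstants (1 / 3) E) :
    ∀ (ω : PairType) (f : Fin (patSize ω) → V), Function.Injective f → E ω = rlaConstants ω := by
  have t24_eq : ∀ f : Fin 4 → V, Function.Injective f → E t24 = 2 / 9 := by
    intro f hf
    have hp : mapEdges f {s(0, 1), s(2, 3)} ∈ indepPairs (⊤ : SimpleGraph V) :=
      mapEdges_mem_indepPairs_top hf (pair_mem_indepPairs_top.2 (by decide))
    have h1 := RandomLayout.integral_α_mul_eq hc hp hp
    simp only [RandomLayout.α_mul_self] at h1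
    rw [hc.prob_eq _ hp, typeOf_mapEdges hf, show typeOf (V := Fin 4) {s(0, 1), s(2, 3)}
      {s(0, 1), s(2, 3)} = t24 by decide] at h1
    linarith
  have t13_eq : ∀ f : Fin 5 → V, Function.Injective f → E t13 = 1 / 18 := by
    intro f hf
    have h1 := rla_card_mul_constants hc hf (s := 0) (t := 1) (u := 2) (v := 3) (s' := 0) (t' := 1)
      (u' := 2) (v' := 4) (by decide) (by decide)
    rw [sum_perm_five,
      show typeOf (V := Fin 5) {s(0, 1), s(2, 3)} {s(0, 1), s(2, 4)} = t13 by decide,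
      show Nat.factorial 5 = 120 from rfl] at h1
    push_cast at h1
    linarith
  have t12_eq : ∀ f : Fin 6 → V, Function.Injective f → E t12 = 1 / 45 := by
    intro f hf
    have h1 := rla_card_mul_constants hc hf (s := 0) (t := 1) (u := 2) (v := 3) (s' := 0) (t' := 1)
      (u' := 4) (v' := 5) (by decide) (by decide)
    rw [sum_perm_six,
      show typeOf (V := Fin 6) {s(0, 1), s(2, 3)} {s(0, 1), s(4, 5)} = t12 by decide,
      show Nat.factorial 6 = 720 from rfl] at h1
    push_cast at h1
    linarith
  have t021_eq : ∀ f : Fin 6 → V, Function.Injective f → E t021 = -1 / 90 := by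
    intro f hf
    have h1 := rla_sum_constants hc hf (patSnd_mem t12) (s := 0) (t := 1) (u := 2) (v := 3)
      (by decide)
    have h2 := t12_eq f hf
    -- Against `{s(0, 1), s(4, 5)}`, the matching that contains `s(0, 1)` has type `12`. The other
    -- two separate the common vertices `0` and `1`, which remain joined by the fixed pair.
    have h3 : E t12 + E t021 + E t021 = 0 := h1
    linarith
  rintro (_ | _ | _ | _ | _ | _ | _ | _ | _) f hf
  · have h1 : E t00 + E t00 + E t00 = 0 := rla_sum_constants (n := 8) hc hf (patSnd_mem t00)
      (s := 0) (t := 1) (u := 2) (v := 3) (by decide)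
    rw [rlaConstants]
    linarith
  · exact t24_eq f hf
  · exact t13_eq f hf
  · exact t12_eq f hf
  · have h1 : E t04 + E t24 + E t04 = 0 := rla_sum_constants (n := 4) hc hf (patSnd_mem t04)
      (s := 0) (t := 1) (u := 2) (v := 3) (by decide)
    rw [rlaConstants]
    linarith [t24_eq f hf]
  · have h1 : E t03 + E t13 + E t03 = 0 := rla_sum_constants (n := 5) hc hf (patSnd_mem t03)
      (s := 0) (t := 1) (u := 2) (v := 3) (by decide)
    rw [rlaConstants]
    linarith [t13_eq f hf]
  · exact t021_eq f hf
  · have h1 : E t022 + E t021 + E t022 = 0 := rla_sum_constants (n := 6) hc hf (patSnd_mem t022)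
      (s := 0) (t := 1) (u := 2) (v := 3) (by decide)
    rw [rlaConstants]
    linarith [t021_eq f hf]
  · have h1 : E t01 + E t01 + E t01 = 0 := rla_sum_constants (n := 7) hc hf (patSnd_mem t01)
      (s := 0) (t := 1) (u := 2) (v := 3) (by decide)
    rw [rlaConstants]
    linarith

theorem rla_hasConstants : (rla V).HasConstants (1 / 3) rlaConstants := by
  obtain ⟨δ, E, hc⟩ := (rla_isExchangeable (V := V)).exists_hasConstants
  have hδ : ∀ p ∈ indepPairs (⊤ : SimpleGraph V), δ = 1 / 3 := by
    intro p hp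
    obtain ⟨s, t, u, v, h, -⟩ := mem_indepPairs.1 hp
    exact rla_prob_eq hc h
  refine ⟨fun p hp => (hc.prob_eq p hp).trans (hδ p hp), fun p hp r hr => ?_⟩
  -- The value of `δ` is forced only if some pair of independent edges exists, so it is substituted
  -- once `p` is at hand.
  obtain rfl := hδ p hp
  rw [hc.expect_eq p hp r hr]
  rcases isPattern_typeOf hp hr with ⟨f, hf, -⟩ | ⟨f, hf, -⟩ <;>
    exact rla_constants_eq hc _ f hf

theorem rla_varianceExpr (G : SimpleGraph V) [DecidableRel G.Adj] : varianceExpr G rlaConstants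
    = (1 / 180) * (8 * (m G + 2) * q G + 2 * K G - (2 * m G + 7) * nL G 4 - 12 * nC4 G
      + 6 * nPaw G - nL G 5 + 6 * nC3L2 G - 3 * Lambda1 G + Lambda2 G - 2 * Phi1 G + Phi2 G) := by
  simp only [varianceExpr, rlaConstants]
  ring

end Linear

end EdgeCrossing

theorem mainTheorem1 {V : Type*} [Fintype V] [DecidableEq V]
    (G : SimpleGraph V) [DecidableRel G.Adj] :
    -- the frequencies of the types
    (freq G t24 = q G ∧
      freq G t13 = K G - 4 * q G - 2 * nL G 4 ∧
      freq G t12 = 2 * ((m G + 2) * q G + nL G 4 - K G) ∧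
      freq G t04 = 2 * nC4 G ∧
      freq G t04 = (1 / 4) * (G.adjMatrix ℝ ^ 4).trace - nL G 3 - (1 / 2) * nL G 2 ∧
      freq G t04 = (1 / 4) * (G.adjMatrix ℝ ^ 4).trace + q G - (1 / 2) * m G ^ 2 ∧
      freq G t03 = Lambda1 G - 2 * nL G 4 - 8 * nC4 G - 2 * nPaw G ∧
      freq G t021 = 2 * q G + (m G + 5) * nL G 4 + 8 * nC4 G + 3 * nPaw G + Phi1 G
        - 3 * nC3L2 G - Lambda1 G - Lambda2 G - K G ∧
      freq G t022 = 4 * q G + 5 * nL G 4 + 2 * nPaw G + 4 * nC4 G + Phi2 G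
        - Lambda2 G - 2 * K G - nL G 5) ∧
    -- the cyclic subgraphs do not occur in forests
    (G.IsAcyclic → nC4 G = 0 ∧ nPaw G = 0 ∧ nC3L2 G = 0) ∧
    -- general layouts
    (∀ (S : Type*) [MeasurableSpace S] (L : RandomLayout V S), L.IsGood →
      (∀ (δ : ℝ) (E : PairType → ℝ), L.HasConstants δ E →
        ProbabilityTheory.variance (fun π => (L.C G π : ℝ)) L.law
          = varianceExpr G E + freq G t00 * E t00 + freq G t01 * E t01 ∧
        (E t00 = 0 → E t01 = 0 →
          ProbabilityTheory.variance (fun π => (L.C G π : ℝ)) L.law = varianceExpr G E ∧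
          (G.IsAcyclic →
            ProbabilityTheory.variance (fun π => (L.C G π : ℝ)) L.law
              = varianceExprForest G E))) ∧
      (L.IsExchangeable → ∃ (δ : ℝ) (E : PairType → ℝ), L.HasConstants δ E) ∧
      (L.IsHomogeneous → ∃ (δ : ℝ) (E : PairType → ℝ),
        L.HasConstants δ E ∧ E t00 = 0 ∧ E t01 = 0)) ∧
    -- uniformly random linear arrangements
    ((rla V).IsGood ∧ (rla V).HasConstants (1 / 3) rlaConstants ∧
      ProbabilityTheory.variance (fun π => ((rla V).C G π : ℝ)) (rla V).law
        = (1 / 180) * (8 * (m G + 2) * q G + 2 * K G - (2 * m G + 7) * nL G 4 - 12 * nC4 G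
            + 6 * nPaw G - nL G 5 + 6 * nC3L2 G - 3 * Lambda1 G + Lambda2 G
            - 2 * Phi1 G + Phi2 G) ∧
      (G.IsAcyclic →
        ProbabilityTheory.variance (fun π => ((rla V).C G π : ℝ)) (rla V).law
          = (1 / 180) * (8 * (m G + 2) * q G + 2 * K G - (2 * m G + 7) * nL G 4
              - nL G 5 - 3 * Lambda1 G + Lambda2 G - 2 * Phi1 G + Phi2 G))) := by
  refine ⟨⟨freq_t24 G, freq_t13_eq_formula G, freq_t12_eq_formula G, freq_t04_eq_nC4 G,
    freq_t04_eq_trace G, freq_t04_eq_trace_sq G, freq_t03_eq_formula G, freq_t021_eq_formula G,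
    freq_t022_eq_formula G⟩, fun hG => ⟨nC4_eq_zero_of_isAcyclic G hG,
    nPaw_eq_zero_of_isAcyclic G hG, nC3L2_eq_zero_of_isAcyclic G hG⟩,
    fun S _ L hL => ⟨fun δ E hE => ?_, fun h => h.exists_hasConstants,
      fun h => h.exists_hasConstants⟩, rla_isGood, rla_hasConstants, ?_, fun hG => ?_⟩
  · have h1 := RandomLayout.variance_eq_sum_freq G hL hE
    rw [RandomLayout.sum_freq_eq] at h1
    refine ⟨h1, fun h00 h01 => ?_⟩
    rw [h00, h01, mul_zero, mul_zero, add_zero, add_zero] at h1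
    exact ⟨h1, fun hG => h1.trans (RandomLayout.varianceExpr_eq_forest G hG E)⟩
  all_goals
    have h1 := RandomLayout.variance_eq_sum_freq G rla_isGood (rla_hasConstants (V := V))
    rw [RandomLayout.sum_freq_eq, rla_varianceExpr] at h1
    rw [h1]
    simp only [rlaConstants, mul_zero, add_zero]
  rw [nC4_eq_zero_of_isAcyclic G hG, nPaw_eq_zero_of_isAcyclic G hG,
    nC3L2_eq_zero_of_isAcyclic G hG]
  ring
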